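/- Let $\boldsymbol{k}=(k_1,\dots,k_m)$ be a partition of $n$ into $m\ge 2$ positive integers, so that $\mathbb{C}^n=\mathbb{C}^{k_1}\times\dots\times\mathbb{C}^{k_m}$. Let $\mathrm{U}(\boldsymbol{k})=\mathrm{U}(k_1)\times\dots\times\mathrm{U}(k_m)$, block diagonally embedded in $\mathrm{U}(n)$, and for $j=1,\dots,m$ let $\mathrm{U}(\boldsymbol{k},j,\mathbb{T})$ be the subgroup obtained by replacing the factor $\mathrm{U}(k_j)$ with the scalar matrices $\mathbb{T}I$. A symbol $a\in L^\infty(\mathbb{B}^n)$ is invariant under a subgroup $H\subseteq\mathrm{U}(n)$ if $a\circ A=a$ almost everywhere for every $A\in H$; it is called $\boldsymbol{k}$-quasi-radial if it is $\mathrm{U}(\boldsymbol{k})$-invariant, and $(\boldsymbol{k},j)$-quasi-radial quasi-homogeneous if it is $\mathrm{U}(\boldsymbol{k},j,\mathbb{T})$-invariant. For $\lambda>-1$ let $dv_\lambda(z)=\frac{\Gamma(n+\lambda+1)}{\pi^n\Gamma(\lambda+1)}(1-|z|^2)^\lambda\,dv(z)$ on the unit ball $\mathbb{B}^n$, where $v$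 is the Lebesgue measure, let $\mathcal{A}^2_\lambda(\mathbb{B}^n)$ be the space of holomorphic functions in $L^2(\mathbb{B}^n,v_\lambda)$, let $B_\lambda$ be the orthogonal projection of $L^2(\mathbb{B}^n,v_\lambda)$ onto it, and let $T^{(\lambda)}_a f=B_\lambda(af)$ be the Toeplitz operator on $\mathcal{A}^2_\lambda(\mathbb{B}^n)$ with symbol $a$. For a set $\mathcal{S}\subseteq L^\infty(\mathbb{B}^n)$ let $\mathcal{T}^{(\lambda)}(\mathcal{S})$ be the Banach algebra generated by the operators $T^{(\lambda)}_a$, $a\in\mathcal{S}$, i.e. the norm closure of the algebra that they generate in the bounded operators on $\mathcal{A}^2_\lambda(\mathbb{B}^n)$. (1) For every $j=1,\dots,m$ let $a_j\in L^\infty(\mathbb{B}^n)$ be a $(\boldsymbol{k},j)$-quasi-radial quasi-homogeneous symbol, and let \[ \mathcal{S}=L^\infty(\mathbb{B}^n)^{\mathrm{U}(\boldsymbol{k})}\cup\{a_j\mid j=1,\dots,m\}. \] Then, for every $\lambda>-1$, the Banach algebra $\mathcal{T}^{(\lambda)}(\mathcal{S})$ is commutative. (2) In general this algebra is not a $C^*$-algebra: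 if $k_j\ge 2$ for some $j$, then there are symbols $a_1,\dots,a_m$ as in (1) such that, for every $\lambda>-1$, the algebra $\mathcal{T}^{(\lambda)}(\mathcal{S})$ with the operator norm is not a $C^*$-algebra for any involution (in particular, it is not closed under adjoints). -/

import Mathlib

open MeasureTheory Metric Filter Topology
open scoped ENNReal ComplexConjugate

noncomputable section

namespace BallToeplitz

/-- The measure `v_λ` on the unit ball of `ℂⁿ` (`n = card ι`), viewed as a measure on `ℂⁿ` which
vanishes off the ball: `dv_λ(z) = c_λ (1 - |z|²)^λ dv(z)` with `v` the Lebesgue measure and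
`c_λ = Γ(n + λ + 1) / (πⁿ Γ(λ + 1))`. -/
def weightedVolume (ι : Type*) [Fintype ι] (lam : ℝ) : Measure (EuclideanSpace ℂ ι) :=
  (volume.restrict (ball 0 1)).withDensity fun z =>
    ENNReal.ofReal (Real.Gamma (Fintype.card ι + lam + 1) /
      (Real.pi ^ Fintype.card ι * Real.Gamma (lam + 1)) * (1 - ‖z‖ ^ 2) ^ lam)

section Closedness

variable {ι : Type*} [Fintype ι]

/-- The mean value inequality for a holomorphic function on a circle. -/
theorem circle_le {g : EuclideanSpace ℂ ι → ℂ} (hg : DifferentiableOn ℂ g (ball 0 1))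
    {z w : EuclideanSpace ℂ ι} {r : ℝ} (hz : ‖z‖ + r < 1) (hw : ‖w‖ ≤ r) :
    ‖g z‖ₑ * ENNReal.ofReal (2 * Real.pi) ≤
      ∫⁻ θ in Set.Ioc 0 (2 * Real.pi), ‖g (z + circleMap 0 1 θ • w)‖ₑ := by
  have h1 : DiffContOnCl ℂ (fun ζ : ℂ => g (z + ζ • w)) (ball 0 |1|) := by
    apply DifferentiableOn.diffContOnCl
    rw [abs_one, closure_ball _ one_ne_zero]
    refine hg.comp (by fun_prop) fun ζ hζ => ?_
    have hζ' : ‖ζ‖ ≤ 1 := by simpa using hζ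
    have := norm_add_le z (ζ • w)
    rw [norm_smul] at this
    have : ‖ζ‖ * ‖w‖ ≤ 1 * ‖w‖ := by gcongr
    simp only [mem_ball_zero_iff]
    linarith
  have h2 := h1.circleAverage
  have hpi : (0 : ℝ) < 2 * Real.pi := by positivity
  simp only [zero_smul, add_zero, Real.circleAverage] at h2
  have h3 : (2 * Real.pi) • g z = ∫ θ in (0 : ℝ)..2 * Real.pi, g (z + circleMap 0 1 θ • w) := by
    rw [← h2, smul_smul, mul_inv_cancel₀ hpi.ne', one_smul]
  rw [intervalIntegral.integral_of_le hpi.le] at h3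
  calc _ = ‖(2 * Real.pi) • g z‖ₑ := by
        rw [enorm_smul, mul_comm, Real.enorm_eq_ofReal hpi.le]
    _ ≤ _ := by rw [h3]; exact enorm_integral_le_lintegral_enorm _

/-- The sub-mean value inequality for a holomorphic function on a ball. -/
theorem meanvalue {g : EuclideanSpace ℂ ι → ℂ} (hg : DifferentiableOn ℂ g (ball 0 1))
    {z : EuclideanSpace ℂ ι} {r : ℝ} (hz : ‖z‖ + r < 1) :
    ‖g z‖ₑ * volume (ball (0 : EuclideanSpace ℂ ι) r) ≤ ∫⁻ w in ball z r, ‖g w‖ₑ := by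
  classical
  set G : EuclideanSpace ℂ ι → ℂ := (ball 0 1).piecewise g 0 with hG
  have hGm : Measurable G :=
    hg.continuousOn.measurable_piecewise continuousOn_const measurableSet_ball
  have hGg : ∀ w ∈ ball (0 : EuclideanSpace ℂ ι) 1, G w = g w := fun w hw =>
    Set.piecewise_eq_of_mem _ _ _ hw
  have hsub : ∀ (θ : ℝ), ∀ w ∈ ball (0 : EuclideanSpace ℂ ι) r,
      z + circleMap 0 1 θ • w ∈ ball (0 : EuclideanSpace ℂ ι) 1 := by
    intro θ w hw
    rw [mem_ball_zero_iff] at hw ⊢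
    have := norm_add_le z (circleMap 0 1 θ • w)
    rw [norm_smul, norm_circleMap_zero, abs_one, one_mul] at this
    linarith
  have hrot : ∀ θ : ℝ, ∫⁻ w in ball (0 : EuclideanSpace ℂ ι) r,
      ‖G (z + circleMap 0 1 θ • w)‖ₑ = ∫⁻ w in ball z r, ‖G w‖ₑ := by
    intro θ
    let e : EuclideanSpace ℂ ι ≃ₗᵢ[ℝ] EuclideanSpace ℂ ι :=
      { toLinearEquiv := LinearEquiv.ofBijective
          (DistribSMul.toLinearMap ℝ (EuclideanSpace ℂ ι) (circleMap 0 1 θ))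
          (by
            have hne : circleMap 0 1 θ ≠ 0 := circleMap_ne_center one_ne_zero
            exact MulAction.bijective₀ hne)
        norm_map' := fun w => (norm_smul (circleMap 0 1 θ) w).trans (by simp) }
    have he : ∀ w, e w = circleMap 0 1 θ • w := fun w => rfl
    have hmp : MeasurePreserving (fun w => z + e w) volume volume :=
      (measurePreserving_add_left volume z).comp e.measurePreserving
    have hpre : (fun w => z + e w) ⁻¹' ball z r = ball 0 r := by
      ext w; simp
    have := (hmp.restrict_preimage (measurableSet_ball (x := z) (ε := r)))
    rw [hpre] at this
    rw [← this.lintegral_comp (hGm.enorm)]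
    simp [he]
  have hpi : (0 : ℝ) < 2 * Real.pi := by positivity
  have hpi0 : ENNReal.ofReal (2 * Real.pi) ≠ 0 := by simpa using Real.pi_pos
  have key : ENNReal.ofReal (2 * Real.pi) *
      (‖g z‖ₑ * volume (ball (0 : EuclideanSpace ℂ ι) r)) ≤
      ENNReal.ofReal (2 * Real.pi) * ∫⁻ w in ball z r, ‖G w‖ₑ := by
    calc _ = ∫⁻ w in ball (0 : EuclideanSpace ℂ ι) r,
          ‖g z‖ₑ * ENNReal.ofReal (2 * Real.pi) := by
          rw [lintegral_const, Measure.restrict_apply_univ]; ring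
      _ ≤ ∫⁻ w in ball (0 : EuclideanSpace ℂ ι) r,
          ∫⁻ θ in Set.Ioc 0 (2 * Real.pi), ‖G (z + circleMap 0 1 θ • w)‖ₑ := by
          refine setLIntegral_mono' measurableSet_ball fun w hw => ?_
          refine (circle_le hg hz (w := w) (by simpa using (mem_ball_zero_iff.1 hw).le)).trans_eq ?_
          exact lintegral_congr fun θ => by rw [hGg _ (hsub θ w hw)]
      _ = ∫⁻ θ in Set.Ioc 0 (2 * Real.pi), ∫⁻ w in ball (0 : EuclideanSpace ℂ ι) r,
          ‖G (z + circleMap 0 1 θ • w)‖ₑ := by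
          refine lintegral_lintegral_swap (Measurable.aemeasurable ?_)
          refine (hGm.comp ?_).enorm
          fun_prop
      _ = _ := by
          simp_rw [hrot]
          rw [lintegral_const, Measure.restrict_apply_univ, Real.volume_Ioc, sub_zero, mul_comm]
  rw [ENNReal.mul_le_mul_iff_right hpi0 ENNReal.ofReal_ne_top] at key
  refine key.trans_eq (setLIntegral_congr_fun measurableSet_ball fun w hw => ?_)
  have : w ∈ ball (0 : EuclideanSpace ℂ ι) 1 := by
    rw [mem_ball_zero_iff]
    have h1 := norm_sub_norm_le w z
    rw [mem_ball, dist_eq_norm] at hw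
    linarith
  simp only [hGg w this]

/-- Lebesgue measure is dominated by a multiple of `v_λ` on smaller balls. -/
theorem restrict_le_weightedVolume (lam : ℝ) (h0 : weightedVolume ι lam ≠ 0) {ρ : ℝ} (hρ : ρ < 1) :
    ∃ C : ℝ≥0∞, C ≠ ⊤ ∧ volume.restrict (ball (0 : EuclideanSpace ℂ ι) ρ) ≤
      C • weightedVolume ι lam := by
  set c := Real.Gamma (Fintype.card ι + lam + 1) /
      (Real.pi ^ Fintype.card ι * Real.Gamma (lam + 1)) with hc
  have hcpos : 0 < c := by
    by_contra h
    push Not at h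
    apply h0
    have : (fun z : EuclideanSpace ℂ ι => ENNReal.ofReal (c * (1 - ‖z‖ ^ 2) ^ lam))
        =ᵐ[volume.restrict (ball 0 1)] 0 := by
      filter_upwards [ae_restrict_mem measurableSet_ball] with z hz
      rw [mem_ball_zero_iff] at hz
      have : 0 ≤ 1 - ‖z‖ ^ 2 := by nlinarith [norm_nonneg z]
      exact ENNReal.ofReal_of_nonpos (mul_nonpos_of_nonpos_of_nonneg h (by positivity))
    rw [weightedVolume, ← hc, withDensity_congr_ae this, withDensity_zero]
  set w : EuclideanSpace ℂ ι → ℝ := fun z => c * (1 - ‖z‖ ^ 2) ^ lam with hw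
  have hpos : ∀ z ∈ ball (0 : EuclideanSpace ℂ ι) 1, 0 < 1 - ‖z‖ ^ 2 := fun z hz => by
    rw [mem_ball_zero_iff] at hz
    nlinarith [norm_nonneg z]
  have hsub : closedBall (0 : EuclideanSpace ℂ ι) ρ ⊆ ball 0 1 := closedBall_subset_ball hρ
  obtain ⟨m, hm0, hm⟩ : ∃ m > 0, ∀ z ∈ closedBall (0 : EuclideanSpace ℂ ι) ρ, m ≤ w z := by
    refine (isCompact_closedBall _ _).exists_forall_le' (a := 0) ?_ ?_
    · refine continuousOn_const.mul (ContinuousOn.rpow_const (by fun_prop) fun z hz => ?_)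
      exact Or.inl (hpos z (hsub hz)).ne'
    · intro z hz
      have := hpos z (hsub hz)
      positivity
  refine ⟨(ENNReal.ofReal m)⁻¹, by simpa using hm0, ?_⟩
  have hm0' : ENNReal.ofReal m ≠ 0 := by simpa using hm0
  refine Measure.le_iff.2 fun s hs => ?_
  rw [Measure.smul_apply, smul_eq_mul, mul_comm, ← div_eq_mul_inv,
    ENNReal.le_div_iff_mul_le (Or.inl hm0') (Or.inl ENNReal.ofReal_ne_top)]
  rw [weightedVolume, withDensity_apply _ hs, Measure.restrict_restrict hs,
    Measure.restrict_apply hs, mul_comm, ← setLIntegral_const]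
  calc _ ≤ ∫⁻ z in s ∩ ball 0 ρ, ENNReal.ofReal (w z) := by
        refine setLIntegral_mono' (hs.inter measurableSet_ball) fun z hz => ?_
        exact ENNReal.ofReal_le_ofReal (hm z (ball_subset_closedBall hz.2))
    _ ≤ _ := lintegral_mono_set (by gcongr)

/-- Point evaluations are uniformly bounded in the `L²(v_λ)` norm on smaller balls. -/
theorem point_le (lam : ℝ) (h0 : weightedVolume ι lam ≠ 0) {ρ : ℝ} (hρ : ρ < 1) :
    ∃ C : ℝ≥0∞, C ≠ ⊤ ∧ ∀ g : EuclideanSpace ℂ ι → ℂ, DifferentiableOn ℂ g (ball 0 1) →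
      ∀ z ∈ ball (0 : EuclideanSpace ℂ ι) ρ, ‖g z‖ₑ ≤ C * eLpNorm g 2 (weightedVolume ι lam) := by
  set r : ℝ := (1 - ρ) / 2 with hr
  have hr0 : 0 < r := by linarith
  obtain ⟨C, hC, hle⟩ := restrict_le_weightedVolume (ι := ι) lam h0 (ρ := ρ + r) (by linarith)
  set V := volume (ball (0 : EuclideanSpace ℂ ι) r)
  have hV0 : V ≠ 0 := (measure_ball_pos _ _ hr0).ne'
  have hVt : V ≠ ⊤ := measure_ball_lt_top.ne
  refine ⟨V⁻¹ * (C ^ (1 / 2 : ℝ≥0∞).toReal * V ^ (1 / 2 : ℝ)), ?_, fun g hg z hz => ?_⟩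
  · refine ENNReal.mul_ne_top (by simpa using hV0) (ENNReal.mul_ne_top ?_ ?_)
    · exact ENNReal.rpow_ne_top_of_nonneg (by positivity) hC
    · exact ENNReal.rpow_ne_top_of_nonneg (by positivity) hVt
  · rw [mem_ball_zero_iff] at hz
    have hzr : ‖z‖ + r < 1 := by linarith
    have h1 := meanvalue hg hzr
    have hsub : ball z r ⊆ ball 0 (ρ + r) := by
      refine ball_subset_ball' ?_
      rw [dist_zero_right]; linarith
    have hsub1 : ball z r ⊆ ball 0 1 := hsub.trans (ball_subset_ball (by linarith))
    have hmeas : AEStronglyMeasurable g (volume.restrict (ball z r)) :=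
      (hg.continuousOn.mono hsub1).aestronglyMeasurable measurableSet_ball
    have h2 : ∫⁻ w in ball z r, ‖g w‖ₑ ≤
        eLpNorm g 2 (weightedVolume ι lam) * (C ^ (1 / 2 : ℝ≥0∞).toReal * V ^ (1 / 2 : ℝ)) := by
      rw [← eLpNorm_one_eq_lintegral_enorm]
      refine (eLpNorm_le_eLpNorm_mul_rpow_measure_univ (p := 1) (q := 2) (by norm_num) hmeas).trans ?_
      rw [Measure.restrict_apply_univ, Measure.addHaar_ball_center]
      have h3 : eLpNorm g 2 (volume.restrict (ball z r)) ≤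
          C ^ (1 / 2 : ℝ≥0∞).toReal * eLpNorm g 2 (weightedVolume ι lam) := by
        refine (eLpNorm_mono_measure g
          ((Measure.restrict_mono hsub le_rfl).trans hle)).trans ?_
        exact eLpNorm_smul_measure_le _ _ _ _
      rw [mul_comm (eLpNorm g 2 (weightedVolume ι lam))]
      refine (mul_le_mul_left h3 _).trans_eq ?_
      norm_num
      ring
    calc ‖g z‖ₑ = V⁻¹ * (‖g z‖ₑ * V) := by
          rw [mul_comm ‖g z‖ₑ, ← mul_assoc, ENNReal.inv_mul_cancel hV0 hVt, one_mul]
      _ ≤ _ := by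
          rw [mul_assoc, mul_comm _ (eLpNorm g 2 _)]
          exact mul_le_mul_right (h1.trans h2) _

/-- A Cauchy estimate for the derivative. -/
theorem fderiv_le {h : EuclideanSpace ℂ ι → ℂ} (hh : DifferentiableOn ℂ h (ball 0 1))
    {ρ r δ : ℝ} (hr : 0 < r) (hρ : ρ + r < 1)
    (hδ : ∀ z ∈ ball (0 : EuclideanSpace ℂ ι) (ρ + r), ‖h z‖ ≤ δ)
    {z : EuclideanSpace ℂ ι} (hz : z ∈ ball (0 : EuclideanSpace ℂ ι) ρ) :
    ‖fderiv ℂ h z‖ ≤ 2 * δ / r := by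
  have hsub : ball z r ⊆ ball 0 (ρ + r) := by
    refine ball_subset_ball' ?_
    rw [mem_ball] at hz
    linarith
  refine Complex.norm_fderiv_le_div_of_mapsTo_ball
    (hh.mono (hsub.trans (ball_subset_ball hρ.le))) (fun w hw => ?_) hr
  rw [mem_closedBall, dist_eq_norm]
  have := norm_sub_le (h w) (h z)
  have := hδ w (hsub hw)
  have := hδ z (hsub (mem_ball_self hr))
  linarith

/-- The weighted Bergman space `A²_λ(𝔹ⁿ)`: the elements of `L²(𝔹ⁿ, v_λ)` that are represented by a
function holomorphic on the unit ball. -/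
def bergmanSubmodule (ι : Type*) [Fintype ι] (lam : ℝ) :
    Submodule ℂ (Lp ℂ 2 (weightedVolume ι lam)) where
  carrier := {f | ∃ g : EuclideanSpace ℂ ι → ℂ,
    DifferentiableOn ℂ g (ball 0 1) ∧ f =ᵐ[weightedVolume ι lam] g}
  add_mem' := by
    rintro f₁ f₂ ⟨g₁, hg₁, h₁⟩ ⟨g₂, hg₂, h₂⟩
    exact ⟨g₁ + g₂, hg₁.add hg₂, (Lp.coeFn_add f₁ f₂).trans (h₁.add h₂)⟩
  zero_mem' := ⟨0, differentiableOn_const 0, Lp.coeFn_zero ℂ 2 _⟩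
  smul_mem' := by
    rintro c f ⟨g, hg, h⟩
    exact ⟨c • g, hg.const_smul c, (Lp.coeFn_smul c f).trans (h.const_smul c)⟩

/-- The Bergman space is closed in `L²(𝔹ⁿ, v_λ)`. -/
theorem isClosed_bergmanSubmodule (lam : ℝ) :
    IsClosed (bergmanSubmodule ι lam : Set (Lp ℂ 2 (weightedVolume ι lam))) := by
  by_cases h0 : weightedVolume ι lam = 0
  · convert isClosed_univ
    refine Set.eq_univ_of_forall fun f => ⟨0, differentiableOn_const 0, ?_⟩
    have hbot : ae (weightedVolume ι lam) = ⊥ := by rw [h0]; exact ae_zero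
    rw [Filter.EventuallyEq, hbot]
    exact eventually_bot
  refine IsSeqClosed.isClosed fun F f hF hlim => ?_
  choose G hG hFG using hF
  have hsub : ∀ p q : ℕ, DifferentiableOn ℂ (fun z => G p z - G q z) (ball 0 1) :=
    fun p q => (hG p).sub (hG q)
  have hnorm : ∀ p q : ℕ, eLpNorm (fun z => G p z - G q z) 2 (weightedVolume ι lam) =
      edist (F p) (F q) := fun p q => by
    rw [Lp.edist_def]
    exact eLpNorm_congr_ae ((hFG p).sub (hFG q)).symm
  -- uniform Cauchy property on smaller balls
  have hcau : ∀ ρ < (1 : ℝ), ∀ ε > (0 : ℝ), ∃ N : ℕ, ∀ p ≥ N, ∀ q ≥ N,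
      ∀ z ∈ ball (0 : EuclideanSpace ℂ ι) ρ, ‖G p z - G q z‖ ≤ ε := by
    intro ρ hρ ε hε
    obtain ⟨C, hC, hle⟩ := point_le lam h0 hρ
    have hCF : Tendsto (fun pq : ℕ × ℕ => C * edist (F pq.1) (F pq.2)) atTop (𝓝 0) := by
      have := (cauchySeq_iff_tendsto_dist_atTop_0.1 hlim.cauchySeq)
      have h2 : Tendsto (fun pq : ℕ × ℕ => edist (F pq.1) (F pq.2)) atTop (𝓝 0) := by
        simp_rw [edist_dist]
        simpa using ENNReal.tendsto_ofReal this
      simpa using ENNReal.Tendsto.const_mul h2 (Or.inr hC)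
    have hev := hCF.eventually_le_const (u := ENNReal.ofReal ε) (by simpa using hε)
    obtain ⟨⟨N₁, N₂⟩, hN⟩ := eventually_atTop.1 hev
    refine ⟨max N₁ N₂, fun p hp q hq z hz => ?_⟩
    have h1 := hle _ (hsub p q) z hz
    rw [hnorm] at h1
    have h2 := h1.trans (hN (p, q) ⟨(le_max_left _ _).trans hp, (le_max_right _ _).trans hq⟩)
    rwa [← ofReal_norm, ENNReal.ofReal_le_ofReal_iff hε.le] at h2
  have hdiff : ∀ (p : ℕ), ∀ z ∈ ball (0 : EuclideanSpace ℂ ι) 1, DifferentiableAt ℂ (G p) z :=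
    fun p z hz => (hG p).differentiableAt (isOpen_ball.mem_nhds hz)
  have hcau' : ∀ ρ < (1 : ℝ), ∀ ε > (0 : ℝ), ∃ N : ℕ, ∀ p ≥ N, ∀ q ≥ N,
      ∀ z ∈ ball (0 : EuclideanSpace ℂ ι) ρ, ‖fderiv ℂ (G p) z - fderiv ℂ (G q) z‖ ≤ ε := by
    intro ρ hρ ε hε
    set r : ℝ := (1 - ρ) / 2 with hr
    have hr0 : 0 < r := by linarith
    obtain ⟨N, hN⟩ := hcau (ρ + r) (by linarith) (ε * r / 2) (by positivity)
    refine ⟨N, fun p hp q hq z hz => ?_⟩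
    have h1 := fderiv_le (hsub p q) hr0 (by linarith) (hN p hp q hq) hz
    have hz1 := ball_subset_ball hρ.le hz
    rw [fderiv_fun_sub (hdiff p z hz1) (hdiff q z hz1)] at h1
    refine h1.trans_eq ?_
    field_simp
  have hptw : ∀ z ∈ ball (0 : EuclideanSpace ℂ ι) 1, ∃ ρ < 1, z ∈ ball (0 : EuclideanSpace ℂ ι) ρ := by
    intro z hz
    rw [mem_ball_zero_iff] at hz
    obtain ⟨ρ, h1, h2⟩ := exists_between hz
    exact ⟨ρ, h2, by simpa using h1⟩
  have hlimG : ∀ z ∈ ball (0 : EuclideanSpace ℂ ι) 1, ∃ l, Tendsto (fun p => G p z) atTop (𝓝 l) := by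
    intro z hz
    obtain ⟨ρ, hρ, hzρ⟩ := hptw z hz
    refine cauchySeq_tendsto_of_complete (Metric.cauchySeq_iff.2 fun ε hε => ?_)
    obtain ⟨N, hN⟩ := hcau ρ hρ (ε / 2) (by positivity)
    refine ⟨N, fun p hp q hq => ?_⟩
    rw [dist_eq_norm]
    linarith [hN p hp q hq z hzρ]
  have hlimG' : ∀ z ∈ ball (0 : EuclideanSpace ℂ ι) 1,
      ∃ l, Tendsto (fun p => fderiv ℂ (G p) z) atTop (𝓝 l) := by
    intro z hz
    obtain ⟨ρ, hρ, hzρ⟩ := hptw z hz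
    refine cauchySeq_tendsto_of_complete (Metric.cauchySeq_iff.2 fun ε hε => ?_)
    obtain ⟨N, hN⟩ := hcau' ρ hρ (ε / 2) (by positivity)
    refine ⟨N, fun p hp q hq => ?_⟩
    rw [dist_eq_norm]
    linarith [hN p hp q hq z hzρ]
  choose! g hg using hlimG
  choose! g' hg' using hlimG'
  refine ⟨g, fun z hz => ?_, ?_⟩
  · obtain ⟨ρ, hρ, hzρ⟩ := hptw z hz
    have hsubρ : ball (0 : EuclideanSpace ℂ ι) ρ ⊆ ball 0 1 := ball_subset_ball hρ.le
    have hunif : TendstoUniformlyOn (fun p z => fderiv ℂ (G p) z) g' atTop (ball 0 ρ) := by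
      refine UniformCauchySeqOn.tendstoUniformlyOn_of_tendsto
        (Metric.uniformCauchySeqOn_iff.2 fun ε hε => ?_) fun z hz => hg' z (hsubρ hz)
      obtain ⟨N, hN⟩ := hcau' ρ hρ (ε / 2) (by positivity)
      refine ⟨N, fun p hp q hq z hz => ?_⟩
      rw [dist_eq_norm]
      linarith [hN p hp q hq z hz]
    exact (hasFDerivAt_of_tendstoUniformlyOn isOpen_ball hunif
      (fun p z hz => (hdiff p z (hsubρ hz)).hasFDerivAt) (fun z hz => hg z (hsubρ hz))
      hzρ).differentiableAt.differentiableWithinAt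
  · obtain ⟨ns, hns, hae⟩ := (tendstoInMeasure_of_tendsto_Lp hlim).exists_seq_tendsto_ae
    have hball : ∀ᵐ z ∂(weightedVolume ι lam), z ∈ ball (0 : EuclideanSpace ℂ ι) 1 :=
      (withDensity_absolutelyContinuous _ _).ae_le (ae_restrict_mem measurableSet_ball)
    filter_upwards [hae, hball, ae_all_iff.2 hFG] with z h1 h2 h3
    simp_rw [h3] at h1
    exact tendsto_nhds_unique h1 ((hg z h2).comp hns.tendsto_atTop)

end Closedness

/-- The weighted Bergman space `A²_λ(𝔹ⁿ)` as a Hilbert space, with the inner product of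
`L²(𝔹ⁿ, v_λ)`. -/
def BergmanSpace (ι : Type*) [Fintype ι] (lam : ℝ) : Type _ := bergmanSubmodule ι lam

instance (ι : Type*) [Fintype ι] (lam : ℝ) : NormedAddCommGroup (BergmanSpace ι lam) :=
  inferInstanceAs (NormedAddCommGroup (bergmanSubmodule ι lam))

instance (ι : Type*) [Fintype ι] (lam : ℝ) : InnerProductSpace ℂ (BergmanSpace ι lam) :=
  inferInstanceAs (InnerProductSpace ℂ (bergmanSubmodule ι lam))

instance (ι : Type*) [Fintype ι] (lam : ℝ) : CompleteSpace (bergmanSubmodule ι lam) :=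
  (isClosed_bergmanSubmodule lam).completeSpace_coe

instance (ι : Type*) [Fintype ι] (lam : ℝ) : CompleteSpace (BergmanSpace ι lam) :=
  inferInstanceAs (CompleteSpace (bergmanSubmodule ι lam))

/-- The space `L^∞(𝔹ⁿ)` of symbols (with respect to Lebesgue measure on the ball). -/
abbrev SymbolSpace (ι : Type*) [Fintype ι] : Type _ :=
  Lp ℂ ∞ (volume.restrict (ball (0 : EuclideanSpace ℂ ι) 1))

/-- A symbol viewed as an element of `L^∞(𝔹ⁿ, v_λ)`. -/
def weightedSymbol {ι : Type*} [Fintype ι] (lam : ℝ) (a : SymbolSpace ι) :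
    Lp ℂ ∞ (weightedVolume ι lam) :=
  MemLp.toLp (⇑a) <| by
    have hac : weightedVolume ι lam ≪ volume.restrict (ball 0 1) :=
      withDensity_absolutelyContinuous _ _
    refine ⟨(Lp.aestronglyMeasurable a).mono_ac hac, lt_of_le_of_lt ?_ (Lp.memLp a).2⟩
    rw [eLpNorm_exponent_top, eLpNorm_exponent_top]
    exact eLpNormEssSup_mono_measure _ hac

/-- Multiplication by the symbol `a` on `L²(𝔹ⁿ, v_λ)`. -/
def mulOperator {ι : Type*} [Fintype ι] (lam : ℝ) (a : SymbolSpace ι) :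
    Lp ℂ 2 (weightedVolume ι lam) →L[ℂ] Lp ℂ 2 (weightedVolume ι lam) :=
  (ContinuousLinearMap.mul ℂ ℂ).holderL (weightedVolume ι lam) ∞ 2 2 (weightedSymbol lam a)

/-- The Toeplitz operator `T_a f = B_λ (a f)` on `A²_λ(𝔹ⁿ)`, where `B_λ` is the Bergman projection,
that is, the orthogonal projection of `L²(𝔹ⁿ, v_λ)` onto `A²_λ(𝔹ⁿ)`. -/
def toeplitz {ι : Type*} [Fintype ι] (lam : ℝ) (a : SymbolSpace ι) :
    BergmanSpace ι lam →L[ℂ] BergmanSpace ι lam :=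
  (bergmanSubmodule ι lam).orthogonalProjectionOnto ∘L mulOperator lam a ∘L
    (bergmanSubmodule ι lam).subtypeL

/-- The Banach algebra generated by the Toeplitz operators with symbols in `S`: the norm closure of
the algebra they generate in the bounded operators on `A²_λ(𝔹ⁿ)`. -/
def toeplitzAlgebra {ι : Type*} [Fintype ι] (lam : ℝ) (S : Set (SymbolSpace ι)) :
    Subalgebra ℂ (BergmanSpace ι lam →L[ℂ] BergmanSpace ι lam) :=
  (Algebra.adjoin ℂ (toeplitz lam '' S)).topologicalClosure

/-- A symbol `a` is `H`-invariant, for a subgroup `H` of `U(n)`, if `a ∘ A = a` in `L^∞(𝔹ⁿ)` for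
every `A ∈ H`. -/
def IsInvariant {ι : Type*} [Fintype ι] [DecidableEq ι]
    (H : Subgroup (Matrix.unitaryGroup ι ℂ)) (a : SymbolSpace ι) : Prop :=
  ∀ A ∈ H, (fun z => a (Matrix.toEuclideanLin (A : Matrix ι ι ℂ) z))
    =ᵐ[volume.restrict (ball (0 : EuclideanSpace ℂ ι) 1)] a

/-- The index set of the coordinates of `ℂⁿ = ℂ^{k_1} × ⋯ × ℂ^{k_m}`. -/
abbrev Coord {m : ℕ} (k : Fin m → ℕ) : Type := Σ j : Fin m, Fin (k j)

/-- The block diagonal embedding of `U(k_1) × ⋯ × U(k_m)` into `U(n)`. -/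
def blockDiag {m : ℕ} (k : Fin m → ℕ) :
    (∀ j, Matrix.unitaryGroup (Fin (k j)) ℂ) →* Matrix.unitaryGroup (Coord k) ℂ where
  toFun B := ⟨Matrix.blockDiagonal' fun j => (B j : Matrix (Fin (k j)) (Fin (k j)) ℂ), by
    rw [Matrix.mem_unitaryGroup_iff, Matrix.star_eq_conjTranspose,
      Matrix.blockDiagonal'_conjTranspose, ← Matrix.blockDiagonal'_mul]
    have h : ∀ j, (B j : Matrix (Fin (k j)) (Fin (k j)) ℂ) *
        (B j : Matrix (Fin (k j)) (Fin (k j)) ℂ).conjTranspose = 1 := fun j =>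
      Matrix.mem_unitaryGroup_iff.1 (B j).2
    simp_rw [h]
    exact Matrix.blockDiagonal'_one⟩
  map_one' := Subtype.ext Matrix.blockDiagonal'_one
  map_mul' B C := by
    apply Subtype.ext
    change Matrix.blockDiagonal' (fun j => (B j).1 * (C j).1) =
      Matrix.blockDiagonal' (fun j => (B j).1) * Matrix.blockDiagonal' fun j => (C j).1
    rw [Matrix.blockDiagonal'_mul]

/-- The group `U(k) = U(k_1) × ⋯ × U(k_m)`, block diagonally embedded in `U(n)`. -/
def blockUnitary {m : ℕ} (k : Fin m → ℕ) : Subgroup (Matrix.unitaryGroup (Coord k) ℂ) :=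
  (blockDiag k).range

/-- The group `𝕋 I` of unimodular multiples of the identity matrix. -/
def scalarUnitary (d : ℕ) : Subgroup (Matrix.unitaryGroup (Fin d) ℂ) where
  carrier := {B | ∃ t : Circle, (B : Matrix (Fin d) (Fin d) ℂ) = (t : ℂ) • 1}
  one_mem' := ⟨1, by simp⟩
  mul_mem' := by
    rintro B C ⟨t, ht⟩ ⟨u, hu⟩
    exact ⟨t * u, by simp [ht, hu, smul_smul, mul_comm]⟩
  inv_mem' := by
    rintro B ⟨t, ht⟩
    exact ⟨t⁻¹, by simp [Matrix.UnitaryGroup.inv_val, ht, ← Circle.coe_inv_eq_conj]⟩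

/-- The group `U(k, j, 𝕋)`, obtained from `U(k)` by replacing the factor `U(k_j)` by `𝕋 I`. -/
def blockUnitaryScalar {m : ℕ} (k : Fin m → ℕ) (j : Fin m) :
    Subgroup (Matrix.unitaryGroup (Coord k) ℂ) :=
  ((scalarUnitary (k j)).comap (Pi.evalMonoidHom _ j)).map (blockDiag k)

/-- A symbol is `k`-quasi-radial if it is `U(k)`-invariant. -/
def IsQuasiRadial {m : ℕ} (k : Fin m → ℕ) (a : SymbolSpace (Coord k)) : Prop :=
  IsInvariant (blockUnitary k) a

/-- A symbol is `(k, j)`-quasi-radial quasi-homogeneous if it is `U(k, j, 𝕋)`-invariant. -/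
def IsQuasiRadialQuasiHomogeneous {m : ℕ} (k : Fin m → ℕ) (j : Fin m)
    (a : SymbolSpace (Coord k)) : Prop :=
  IsInvariant (blockUnitaryScalar k j) a

/-- The set of symbols `L^∞(𝔹ⁿ)^{U(k)} ∪ {a_j | j = 1, …, m}`. -/
def symbolSet {m : ℕ} (k : Fin m → ℕ) (a : Fin m → SymbolSpace (Coord k)) :
    Set (SymbolSpace (Coord k)) :=
  {b | IsQuasiRadial k b} ∪ Set.range a

/-- The subalgebra `A` of a Banach algebra is, with its norm, a C*-algebra: it is closed, and it
has a conjugate-linear anti-multiplicative involution with `‖x* x‖ = ‖x‖²`. (For an algebra of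
operators which is norm closed and closed under adjoints, the adjoint is such an involution.) -/
def IsCStarAlgebra {B : Type*} [NormedRing B] [NormedAlgebra ℂ B] (A : Subalgebra ℂ B) : Prop :=
  IsClosed (A : Set B) ∧ ∃ s : A → A,
    (∀ x, s (s x) = x) ∧ (∀ x y, s (x + y) = s x + s y) ∧
    (∀ (c : ℂ) (x : A), s (c • x) = conj c • s x) ∧ (∀ x y, s (x * y) = s y * s x) ∧
    ∀ x, ‖s x * x‖ = ‖x‖ ^ 2

end BallToeplitz

end

/-!
Both parts rest on the action of unitary matrices `A` on the Bergman space by `f ↦ f ∘ A` (`rot`):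
if a symbol is invariant under `A`, its Toeplitz operator commutes with `rot A`
(`toeplitz_commute_rot`). The monomials are total in the Bergman space: by Cauchy's formula the
Taylor coefficients of a holomorphic function along complex lines are homogeneous polynomials, and
rotation invariance of `v_λ` shows that a function orthogonal to all polynomials has vanishing
Taylor coefficients (`eq_zero_of_inner_polyVec`).

*Commutativity.* It suffices that operators `T` and `S` commute which commute with `U(k, j, 𝕋)` and
`U(k, l, 𝕋)`, `j ≠ l`, respectively (`commute_of_commute_rot`): a quasi-radial symbol is invariant
under `U(k, l, 𝕋)` for every `l`, and there are at least two blocks. Morally `T` acts only on the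
factor `j`, and `S` on the factor `l`, of the tensor product of the spaces of homogeneous
polynomials in the separate blocks. To see this without representation theory, observe that
commuting with diagonal matrices forces `T` to change a monomial in its block `j` only, where it
preserves the degree (`apply_mono_mem_span`). By polarization, each monomial in the block `j` is a
combination of powers of linear forms, hence is obtained from the power of one coordinate by a
combination `X` of rotations of that block (`exists_apply_mono_concentrate`). Similarly for the
block `l`, with combinations `Y`. So a monomial is `X Y v` with `v` concentrated in both blocks,
`T X v = X' v` and `S Y v = Y' v`. As rotations of the block `j` commute with `S` and with the
rotations of the block `l`, and symmetrically, `T S X Y v = Y' X' v = S T X Y v`.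

*Failure of the C*-property.* In a commutative C*-algebra `‖w ^ 2‖ = ‖w‖ ^ 2`
(`IsCStarAlgebra.norm_mul_self`). Let `p ≠ q` be coordinates in one block, `x` the Toeplitz operator
with symbol `z_p conj z_q`, and `y` the one with the radial symbol `1 - |z|²`. The monomials of
degree `d` are eigenvectors of `y` with an eigenvalue `g d` which strictly decreases in `d`, by the
strict logarithmic convexity of moments (`exists_moment_ratio`). Since `x` lowers the exponent of
`z_q`, its square kills all monomials of degree at most `1`, whereas `x z_q ≠ 0`. Hence, for
`w = x y ^ N`, the norm of `w ^ 2 = x ^ 2 y ^ (2 N)` is at most a constant times `(g 2) ^ (2 N)`,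
while `‖w‖` is at least a positive constant times `(g 1) ^ N`; for large `N` this contradicts
`‖w ^ 2‖ = ‖w‖ ^ 2` (`exists_norm_mul_self_ne`).
-/

namespace BallToeplitz

/-! ### Taylor coefficients of holomorphic functions on the ball -/

section Taylor

variable {ι : Type*} [Fintype ι]

/-- A directional derivative of a holomorphic function on the ball is holomorphic: locally it is
given by Cauchy's integral formula on a circle in that direction, which may be differentiated under
the integral sign. -/
theorem differentiableOn_fderiv_apply {g : EuclideanSpace ℂ ι → ℂ}
    (hg : DifferentiableOn ℂ g (ball 0 1)) (v : EuclideanSpace ℂ ι) :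
    DifferentiableOn ℂ (fun z => fderiv ℂ g z v) (ball 0 1) := by
  intro z₀ hz₀
  rw [mem_ball_zero_iff] at hz₀
  obtain ⟨δ, hδ0, hδ⟩ : ∃ δ > 0, ‖z₀‖ + 4 * δ = 1 := ⟨(1 - ‖z₀‖) / 4, by linarith, by ring⟩
  set t : ℝ := δ / (‖v‖ + 1) with ht
  have hv : 0 < ‖v‖ + 1 := by positivity
  have ht0 : 0 < t := by positivity
  have htv : t * ‖v‖ ≤ δ := by
    rw [ht, div_mul_eq_mul_div, div_le_iff₀ hv]
    nlinarith [norm_nonneg v]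
  have hmem : ∀ z ∈ ball z₀ δ, ∀ ζ : ℂ, ‖ζ‖ ≤ t →
      z + ζ • v ∈ ball (0 : EuclideanSpace ℂ ι) (‖z₀‖ + 2 * δ) := by
    intro z hz ζ hζ
    rw [mem_ball, dist_eq_norm] at hz
    rw [mem_ball_zero_iff]
    have h1 := norm_add_le z (ζ • v)
    have h2 := norm_le_norm_add_norm_sub' z z₀
    rw [norm_smul] at h1
    have h3 : ‖ζ‖ * ‖v‖ ≤ t * ‖v‖ := by gcongr
    linarith
  have hsub : ball (0 : EuclideanSpace ℂ ι) (‖z₀‖ + 2 * δ) ⊆ ball 0 1 :=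
    ball_subset_ball (by linarith)
  obtain ⟨M, hM⟩ := (isCompact_closedBall (0 : EuclideanSpace ℂ ι)
    (‖z₀‖ + 3 * δ)).exists_bound_of_continuousOn
    (hg.continuousOn.mono (closedBall_subset_ball (by linarith)))
  have hgd : ∀ w ∈ ball (0 : EuclideanSpace ℂ ι) 1, HasFDerivAt g (fderiv ℂ g w) w :=
    fun w hw => (hg.differentiableAt (isOpen_ball.mem_nhds hw)).hasFDerivAt
  have hbd : ∀ w ∈ ball (0 : EuclideanSpace ℂ ι) (‖z₀‖ + 2 * δ),
      ‖fderiv ℂ g w‖ ≤ 2 * M / δ := fun w hw =>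
    fderiv_le hg (ρ := ‖z₀‖ + 2 * δ) hδ0 (by linarith)
      (fun z hz => hM z (ball_subset_closedBall (ball_subset_ball (by linarith) hz))) hw
  -- the kernel of Cauchy's formula for the derivative, on the circle of radius `t`
  set κ : ℝ → ℂ := fun θ => deriv (circleMap 0 t) θ * (1 / (circleMap 0 t θ - 0) ^ 2) with hκ
  have hκc : Continuous κ := by
    have : ∀ θ, circleMap 0 t θ ≠ 0 := fun θ => circleMap_ne_center ht0.ne'
    simp only [hκ, deriv_circleMap, sub_zero]
    have hc : Continuous (circleMap 0 t) := continuous_circleMap 0 t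
    exact (hc.mul continuous_const).mul
      (continuous_const.div (hc.pow 2) fun θ => pow_ne_zero 2 (this θ))
  have hc : ∀ θ, ‖circleMap 0 t θ‖ ≤ t := fun θ => by simp [abs_of_pos ht0]
  set μ := (volume : Measure ℝ).restrict (Set.Ioc 0 (2 * Real.pi)) with hμ
  have hcirc : Continuous fun θ => circleMap 0 t θ := continuous_circleMap 0 t
  have hFc : ∀ z ∈ ball z₀ δ, Continuous fun θ => κ θ * g (z + circleMap 0 t θ • v) := by
    intro z hz
    refine hκc.mul ?_
    refine (hg.continuousOn.mono hsub).comp_continuous (by fun_prop) fun θ => hmem z hz _ (hc θ)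
  have hint : ∀ f : ℝ → ℂ, Continuous f → Integrable f μ := fun f hf => by
    have := (hf.intervalIntegrable (μ := volume) 0 (2 * Real.pi)).1
    exact this
  have hz₀δ : z₀ ∈ ball z₀ δ := mem_ball_self hδ0
  have key : HasFDerivAt (fun z => ∫ θ, κ θ * g (z + circleMap 0 t θ • v) ∂μ)
      (∫ θ, κ θ • fderiv ℂ g (z₀ + circleMap 0 t θ • v) ∂μ) z₀ := by
    refine hasFDerivAt_integral_of_dominated_of_fderiv_le (𝕜 := ℂ) (s := ball z₀ δ)
      (bound := fun θ => ‖κ θ‖ * (2 * M / δ))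
      (F' := fun z θ => κ θ • fderiv ℂ g (z + circleMap 0 t θ • v)) (ball_mem_nhds _ hδ0)
      ?_ (hint _ (hFc z₀ hz₀δ)) ?_ ?_ ?_ ?_
    · filter_upwards [ball_mem_nhds z₀ hδ0] with z hz
      exact (hFc z hz).aestronglyMeasurable
    · refine hκc.aestronglyMeasurable.smul ?_
      exact ((measurable_fderiv ℂ g).comp (by fun_prop)).aestronglyMeasurable
    · refine Eventually.of_forall fun θ z hz => ?_
      rw [norm_smul]
      gcongr
      exact hbd _ (hmem z hz _ (hc θ))
    · have : Integrable (fun θ => ‖κ θ‖) μ := (hint κ hκc).norm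
      exact this.mul_const _
    · refine Eventually.of_forall fun θ z hz => ?_
      have h1 := (hgd _ (hsub (hmem z hz _ (hc θ)))).comp z
        ((hasFDerivAt_id (𝕜 := ℂ) z).add_const (circleMap 0 t θ • v))
      simpa using h1.const_mul (κ θ)
  have hcauchy : ∀ z ∈ ball z₀ δ, fderiv ℂ g z v =
      (2 * Real.pi * Complex.I)⁻¹ * ∫ θ, κ θ * g (z + circleMap 0 t θ • v) ∂μ := by
    intro z hz
    have hd : DifferentiableOn ℂ (fun ζ : ℂ => g (z + ζ • v)) (closedBall 0 t) := by
      refine (hg.mono hsub).comp (by fun_prop) fun ζ hζ => hmem z hz ζ (by simpa using hζ)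
    have h1 := hd.deriv_eq_smul_circleIntegral ht0
    have h2 : HasDerivAt (fun ζ : ℂ => g (z + ζ • v)) (fderiv ℂ g z v) 0 := by
      have hz1 : HasFDerivAt g (fderiv ℂ g z) (z + (0 : ℂ) • v) := by
        have := hgd z (hsub (by simpa using hmem z hz 0 (by simpa using ht0.le)))
        simpa using this
      have h3 : HasDerivAt (fun ζ : ℂ => z + ζ • v) v 0 := by
        simpa using ((hasDerivAt_id (0 : ℂ)).smul_const v).const_add z
      exact hz1.comp_hasDerivAt 0 h3
    rw [h2.deriv, circleIntegral, intervalIntegral.integral_of_le (by positivity)] at h1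
    simp only [smul_eq_mul, ← mul_assoc] at h1
    rw [← hμ] at h1
    have hne : (2 * Real.pi * Complex.I : ℂ) ≠ 0 := by simp [Real.pi_ne_zero]
    rw [eq_inv_mul_iff_mul_eq₀ hne, ← h1]
  refine DifferentiableAt.differentiableWithinAt ?_
  refine (key.differentiableAt.const_mul ((2 * Real.pi * Complex.I)⁻¹)).congr_of_eventuallyEq ?_
  filter_upwards [ball_mem_nhds z₀ hδ0] with z hz using hcauchy z hz

/-- The Taylor coefficients of a holomorphic function along complex lines through the origin are
homogeneous polynomials in the direction. -/
theorem exists_isHomogeneous_iteratedDeriv (d : ℕ) {g : EuclideanSpace ℂ ι → ℂ}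
    (hg : DifferentiableOn ℂ g (ball 0 1)) :
    ∃ p : MvPolynomial ι ℂ, p.IsHomogeneous d ∧
      ∀ z : EuclideanSpace ℂ ι, iteratedDeriv d (fun ζ : ℂ => g (ζ • z)) 0 =
        MvPolynomial.eval (fun i => z i) p := by
  classical
  -- `d/dζ g(ζ z) = ∑ i, z i * (∂ i g)(ζ z)`, and the partial derivatives are again holomorphic
  induction d generalizing g with
  | zero =>
    exact ⟨MvPolynomial.C (g 0), MvPolynomial.isHomogeneous_C _ _, fun z => by simp⟩
  | succ d ih =>
    have hpart : ∀ i, ∃ p : MvPolynomial ι ℂ, p.IsHomogeneous d ∧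
      ∀ z : EuclideanSpace ℂ ι,
        iteratedDeriv d (fun ζ : ℂ => fderiv ℂ g (ζ • z) (EuclideanSpace.single i 1)) 0 =
          MvPolynomial.eval (fun i => z i) p :=
      fun i => ih (differentiableOn_fderiv_apply hg (EuclideanSpace.single i 1))
    choose p hp hpz using hpart
    refine ⟨∑ i, MvPolynomial.X i * p i, ?_, fun z => ?_⟩
    · refine MvPolynomial.IsHomogeneous.sum _ _ _ fun i _ => ?_
      rw [add_comm]
      exact (MvPolynomial.isHomogeneous_X ℂ i).mul (hp i)
    · have hnear : ∀ᶠ ζ : ℂ in 𝓝 0, ζ • z ∈ ball (0 : EuclideanSpace ℂ ι) 1 := by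
        have hcont : ContinuousAt (fun ζ : ℂ => ζ • z) 0 := by fun_prop
        refine hcont.eventually_mem ?_
        simpa using ball_mem_nhds (0 : EuclideanSpace ℂ ι) one_pos
      have hz : z = ∑ i, z i • EuclideanSpace.single i (1 : ℂ) := by
        ext j
        simp [Finset.sum_apply, Pi.single_apply]
      have hder : deriv (fun ζ : ℂ => g (ζ • z)) =ᶠ[𝓝 0]
          fun ζ => ∑ i, z i * fderiv ℂ g (ζ • z) (EuclideanSpace.single i 1) := by
        filter_upwards [hnear] with ζ hζ
        have h1 : HasFDerivAt g (fderiv ℂ g (ζ • z)) (ζ • z) :=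
          (hg.differentiableAt (isOpen_ball.mem_nhds hζ)).hasFDerivAt
        have h2 : HasDerivAt (fun ζ : ℂ => ζ • z) z ζ := by
          simpa using (hasDerivAt_id ζ).smul_const z
        have h3 := (h1.comp_hasDerivAt ζ h2).deriv
        have h4 : fderiv ℂ g (ζ • z) z =
            ∑ i, z i * fderiv ℂ g (ζ • z) (EuclideanSpace.single i 1) := by
          conv_lhs => arg 2; rw [hz]
          simp [map_sum]
        rw [← h4, ← h3]
        rfl
      have hcd : ∀ i, ContDiffAt ℂ d
          (fun ζ : ℂ => fderiv ℂ g (ζ • z) (EuclideanSpace.single i 1)) 0 := by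
        intro i
        have h1 : ∀ᶠ ζ : ℂ in 𝓝 0, DifferentiableAt ℂ
            (fun ζ : ℂ => fderiv ℂ g (ζ • z) (EuclideanSpace.single i 1)) ζ := by
          filter_upwards [hnear] with ζ hζ
          have := (differentiableOn_fderiv_apply hg (EuclideanSpace.single i 1)).differentiableAt
            (isOpen_ball.mem_nhds hζ)
          exact DifferentiableAt.comp (f := fun ζ : ℂ => ζ • z) ζ this (by fun_prop)
        exact (Complex.analyticAt_iff_eventually_differentiableAt.2 h1).contDiffAt
      rw [iteratedDeriv_succ', hder.iteratedDeriv_eq, iteratedDeriv_fun_sum]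
      · simp only [map_sum, map_mul, MvPolynomial.eval_X]
        refine Finset.sum_congr rfl fun i _ => ?_
        rw [iteratedDeriv_const_mul_field, hpz]
      · intro i _
        exact contDiffAt_const.mul (hcd i)

/-- Cauchy's formula for the Taylor coefficients at the origin, on the unit circle. -/
theorem circleIntegral_taylor {h : ℂ → ℂ} {R : ℝ} (hR : 1 < R)
    (hh : DifferentiableOn ℂ h (ball 0 R)) (d : ℕ) :
    ∫ θ in Set.Ioc 0 (2 * Real.pi), conj (circleMap 0 1 θ ^ d) * h (circleMap 0 1 θ) =
      2 * Real.pi * ((d.factorial : ℂ)⁻¹ * iteratedDeriv d h 0) := by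
  have h1 : HasFPowerSeriesOnBall h (cauchyPowerSeries h 0 1) 0 1 :=
    (hh.mono (closedBall_subset_ball hR)).hasFPowerSeriesOnBall (R := 1) one_pos
  have h2 := h1.factorial_smul (1 : ℂ) d
  have h3 : iteratedDeriv d h 0 = iteratedFDeriv ℂ d h 0 fun _ => 1 :=
    iteratedDeriv_eq_iteratedFDeriv
  rw [h3, ← h2, cauchyPowerSeries_apply, circleIntegral,
    intervalIntegral.integral_of_le (by positivity)]
  have hne : (d.factorial : ℂ) ≠ 0 := by exact_mod_cast d.factorial_ne_zero
  have hpi : (Real.pi : ℂ) ≠ 0 := by exact_mod_cast Real.pi_ne_zero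
  have hint : ∀ θ : ℝ, deriv (circleMap 0 1) θ • ((1 : ℂ) / (circleMap 0 1 θ - 0)) ^ d •
      (circleMap 0 1 θ - 0)⁻¹ • h (circleMap 0 1 θ) =
      Complex.I * (conj (circleMap 0 1 θ ^ d) * h (circleMap 0 1 θ)) := by
    intro θ
    have hc : circleMap 0 1 θ ≠ 0 := circleMap_ne_center one_ne_zero
    have hconj : conj (circleMap 0 1 θ) = (circleMap 0 1 θ)⁻¹ := by
      rw [Complex.inv_def, Complex.normSq_eq_norm_sq]
      simp
    rw [map_pow, hconj, deriv_circleMap]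
    simp only [smul_eq_mul, sub_zero, one_div]
    field_simp
  simp_rw [hint]
  rw [integral_const_mul, nsmul_eq_mul, smul_eq_mul]
  have hI := Complex.I_ne_zero
  field_simp

end Taylor

/-! ### The measure `v_λ` -/

section Measure

variable {ι : Type*} [Fintype ι]

theorem isFiniteMeasure_weightedVolume [Nonempty ι] {lam : ℝ} (hlam : -1 < lam) :
    IsFiniteMeasure (weightedVolume ι lam) := by
  refine isFiniteMeasure_withDensity_ofReal ?_
  refine (Integrable.const_mul ?_ _).2
  have h := integrableOn_fun_norm_addHaar (volume : Measure (EuclideanSpace ℂ ι))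
    (f := fun y : ℝ => (1 - y ^ 2) ^ lam) (r := 1)
  refine h.2 ?_
  have h1 : IntervalIntegrable (fun y : ℝ => (1 - y) ^ lam) volume 0 1 := by
    have := (intervalIntegral.intervalIntegrable_rpow' (a := 0) (b := 1) hlam).comp_sub_left 1
    simpa using this.symm
  have h2 : ContinuousOn (fun y : ℝ => y ^ (Module.finrank ℝ (EuclideanSpace ℂ ι) - 1) *
      (1 + y) ^ lam) (Set.uIcc 0 1) := by
    refine ContinuousOn.mul (by fun_prop) (ContinuousOn.rpow_const (by fun_prop) fun y hy => ?_)
    rw [Set.uIcc_of_le zero_le_one] at hy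
    have := hy.1
    left; positivity
  have h3 := (intervalIntegrable_iff_integrableOn_Ioo_of_le zero_le_one).1 (h1.continuousOn_mul h2)
  refine h3.congr_fun (fun y hy => ?_) measurableSet_Ioo
  have hy0 := hy.1
  have hy1 := hy.2
  have : 1 - y ^ 2 = (1 + y) * (1 - y) := by ring
  simp only [smul_eq_mul]
  rw [this, Real.mul_rpow (by linarith) (by linarith)]
  ring

theorem ae_mem_ball (lam : ℝ) : ∀ᵐ z ∂weightedVolume ι lam, z ∈ ball (0 : EuclideanSpace ℂ ι) 1 :=
  (withDensity_absolutelyContinuous _ _).ae_le (ae_restrict_mem measurableSet_ball)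

theorem weightedVolume_ac (lam : ℝ) :
    weightedVolume ι lam ≪ volume.restrict (ball (0 : EuclideanSpace ℂ ι) 1) :=
  withDensity_absolutelyContinuous _ _

theorem weight_const_pos {lam : ℝ} (hlam : -1 < lam) :
    0 < Real.Gamma (Fintype.card ι + lam + 1) /
      (Real.pi ^ Fintype.card ι * Real.Gamma (lam + 1)) := by
  have h1 : 0 < Real.Gamma (lam + 1) := Real.Gamma_pos_of_pos (by linarith)
  have h2 : 0 < Real.Gamma (Fintype.card ι + lam + 1) := by
    refine Real.Gamma_pos_of_pos ?_
    have : (0 : ℝ) ≤ Fintype.card ι := by positivity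
    linarith
  have := Real.pi_pos
  positivity

/-- Lebesgue measure on the ball and `v_λ` have the same null sets. -/
theorem ac_weightedVolume {lam : ℝ} (hlam : -1 < lam) :
    volume.restrict (ball (0 : EuclideanSpace ℂ ι) 1) ≪ weightedVolume ι lam := by
  refine withDensity_absolutelyContinuous' ?_ ?_
  · exact Measurable.aemeasurable (by fun_prop)
  · filter_upwards [ae_restrict_mem measurableSet_ball] with z hz
    rw [mem_ball_zero_iff] at hz
    have h1 : 0 < 1 - ‖z‖ ^ 2 := by nlinarith [norm_nonneg z]
    have h2 := weight_const_pos (ι := ι) hlam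
    have : 0 < Real.Gamma (Fintype.card ι + lam + 1) /
      (Real.pi ^ Fintype.card ι * Real.Gamma (lam + 1)) * (1 - ‖z‖ ^ 2) ^ lam := by positivity
    simpa using this

theorem measurePreserving_ball (e : EuclideanSpace ℂ ι ≃ₗᵢ[ℂ] EuclideanSpace ℂ ι) :
    MeasurePreserving e (volume.restrict (ball 0 1)) (volume.restrict (ball 0 1)) := by
  let e' : EuclideanSpace ℂ ι ≃ₗᵢ[ℝ] EuclideanSpace ℂ ι :=
    { e.toLinearEquiv.restrictScalars ℝ with norm_map' := e.norm_map }
  have h := e'.measurePreserving.restrict_preimage (measurableSet_ball (x := 0) (ε := 1))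
  have hpre : e' ⁻¹' ball (0 : EuclideanSpace ℂ ι) 1 = ball 0 1 := by
    ext z
    simp only [Set.mem_preimage, mem_ball_zero_iff]
    rw [e'.norm_map]
  rw [hpre] at h
  exact h

theorem measurePreserving_weightedVolume (lam : ℝ)
    (e : EuclideanSpace ℂ ι ≃ₗᵢ[ℂ] EuclideanSpace ℂ ι) :
    MeasurePreserving e (weightedVolume ι lam) (weightedVolume ι lam) := by
  have he : Measurable e := e.continuous.measurable
  refine ⟨he, Measure.ext fun s hs => ?_⟩
  have hm : Measurable fun z : EuclideanSpace ℂ ι =>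
      ENNReal.ofReal (Real.Gamma (Fintype.card ι + lam + 1) /
      (Real.pi ^ Fintype.card ι * Real.Gamma (lam + 1)) * (1 - ‖z‖ ^ 2) ^ lam) := by fun_prop
  rw [Measure.map_apply he hs, weightedVolume, withDensity_apply _ hs,
    withDensity_apply _ (he hs)]
  rw [← ((measurePreserving_ball e).restrict_preimage hs).lintegral_comp hm]
  simp

end Measure

/-! ### Density of the polynomials -/

section Polynomial

variable {ι : Type*} [Fintype ι] {lam : ℝ}

theorem differentiable_eval (p : MvPolynomial ι ℂ) :
    Differentiable ℂ fun z : EuclideanSpace ℂ ι => MvPolynomial.eval (fun i => z i) p := by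
  induction p using MvPolynomial.induction_on with
  | C a => simp
  | add p q hp hq =>
    simp only [map_add]
    exact hp.add hq
  | mul_X p i hp =>
    simp only [map_mul, MvPolynomial.eval_X]
    refine hp.mul ?_
    exact (EuclideanSpace.proj i : EuclideanSpace ℂ ι →L[ℂ] ℂ).differentiable

theorem continuous_eval (p : MvPolynomial ι ℂ) :
    Continuous fun z : EuclideanSpace ℂ ι => MvPolynomial.eval (fun i => z i) p :=
  (differentiable_eval p).continuous

theorem exists_bound_eval (p : MvPolynomial ι ℂ) :
    ∃ M : ℝ, ∀ᵐ z ∂weightedVolume ι lam, ‖MvPolynomial.eval (fun i => z i) p‖ ≤ M := by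
  obtain ⟨M, hM⟩ := (isCompact_closedBall (0 : EuclideanSpace ℂ ι) 1).exists_bound_of_continuousOn
    (continuous_eval p).continuousOn
  exact ⟨M, (ae_mem_ball lam).mono fun z hz => hM z (ball_subset_closedBall hz)⟩

/-- The inclusion of the Bergman space into `L²(𝔹ⁿ, v_λ)`. -/
noncomputable def toL2 (lam : ℝ) : BergmanSpace ι lam →ₗᵢ[ℂ] Lp ℂ 2 (weightedVolume ι lam) :=
  (bergmanSubmodule ι lam).subtypeₗᵢ

theorem inner_eq_integral (f g : BergmanSpace ι lam) :
    inner ℂ f g = ∫ z, conj (toL2 lam f z) * toL2 lam g z ∂weightedVolume ι lam := by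
  rw [← (toL2 lam).inner_map_map, L2.inner_def]
  simp only [RCLike.inner_apply, mul_comm]

theorem exists_holomorphic_rep (f : BergmanSpace ι lam) : ∃ g : EuclideanSpace ℂ ι → ℂ,
    DifferentiableOn ℂ g (ball 0 1) ∧ toL2 lam f =ᵐ[weightedVolume ι lam] g := f.2

variable [IsFiniteMeasure (weightedVolume ι lam)]

theorem memLp_eval (p : MvPolynomial ι ℂ) (q : ℝ≥0∞) :
    MemLp (fun z : EuclideanSpace ℂ ι => MvPolynomial.eval (fun i => z i) p) q
      (weightedVolume ι lam) := by
  obtain ⟨M, hM⟩ := exists_bound_eval (lam := lam) p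
  exact MemLp.of_bound (continuous_eval p).aestronglyMeasurable M hM

/-- A polynomial, as an element of the Bergman space. -/
noncomputable def polyVec (lam : ℝ) [IsFiniteMeasure (weightedVolume ι lam)] :
    MvPolynomial ι ℂ →ₗ[ℂ] BergmanSpace ι lam where
  toFun p := (⟨(memLp_eval p 2).toLp _, _, (differentiable_eval p).differentiableOn,
    MemLp.coeFn_toLp _⟩ : bergmanSubmodule ι lam)
  map_add' p q := by
    refine Subtype.ext ?_
    change MemLp.toLp _ (memLp_eval (p + q) 2) =
      MemLp.toLp _ (memLp_eval p 2) + MemLp.toLp _ (memLp_eval q 2)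
    rw [← MemLp.toLp_add]
    congr 1
    ext z; simp
  map_smul' c p := by
    refine Subtype.ext ?_
    change MemLp.toLp _ (memLp_eval (c • p) 2) = c • MemLp.toLp _ (memLp_eval p 2)
    rw [← MemLp.toLp_const_smul]
    congr 1
    ext z; simp [MvPolynomial.smul_eval]

theorem toL2_polyVec (p : MvPolynomial ι ℂ) :
    toL2 lam (polyVec lam p) =ᵐ[weightedVolume ι lam]
      fun z => MvPolynomial.eval (fun i => z i) p :=
  MemLp.coeFn_toLp (memLp_eval p 2)

/-- Scalar rotation of `ℂⁿ` by a point of the unit circle. -/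
noncomputable def circleRot (ι : Type*) [Fintype ι] (c : Circle) :
    EuclideanSpace ℂ ι ≃ₗᵢ[ℂ] EuclideanSpace ℂ ι :=
  { LinearEquiv.smulOfNeZero ℂ (EuclideanSpace ℂ ι) (c : ℂ) c.coe_ne_zero with
    norm_map' := fun z => by
      change ‖(c : ℂ) • z‖ = ‖z‖
      rw [norm_smul, Circle.norm_coe, one_mul] }

/-- The polynomials are dense in the Bergman space: if `f` is orthogonal to them, then, integrating
over the rotations `z ↦ e^{iθ} z`, each homogeneous part of `f` is orthogonal to itself. -/
theorem eq_zero_of_inner_polyVec {f : BergmanSpace ι lam}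
    (hf : ∀ p, inner ℂ (polyVec lam p) f = 0) : f = 0 := by
  classical
  obtain ⟨g, hg, hfg⟩ := exists_holomorphic_rep f
  set μ := weightedVolume ι lam with hμ
  set τ := (volume : Measure ℝ).restrict (Set.Ioc 0 (2 * Real.pi)) with hτ
  -- a measurable representative, holomorphic on the ball
  set G : EuclideanSpace ℂ ι → ℂ := (ball 0 1).piecewise g 0 with hG
  have hGm : Measurable G :=
    hg.continuousOn.measurable_piecewise continuousOn_const measurableSet_ball
  have hGg : ∀ w ∈ ball (0 : EuclideanSpace ℂ ι) 1, G w = g w := fun w hw =>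
    Set.piecewise_eq_of_mem _ _ _ hw
  have hfG : toL2 lam f =ᵐ[μ] G := by
    filter_upwards [hfg, ae_mem_ball lam] with z h1 h2 using h1.trans (hGg z h2).symm
  have hG2 : MemLp G 2 μ := (memLp_congr_ae hfG).1 (Lp.memLp _)
  have hG1 : Integrable G μ := hG2.integrable one_le_two
  choose p hp hpz using fun d => exists_isHomogeneous_iteratedDeriv d hg
  have hpi : (Real.pi : ℂ) ≠ 0 := by exact_mod_cast Real.pi_ne_zero
  have hslice : ∀ z ∈ ball (0 : EuclideanSpace ℂ ι) 1, ∃ R > 1,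
      DifferentiableOn ℂ (fun ζ : ℂ => g (ζ • z)) (ball 0 R) := by
    intro z hz
    rw [mem_ball_zero_iff] at hz
    obtain ⟨ρ, h1, h2⟩ := exists_between hz
    have hρ : 0 < ρ := (norm_nonneg z).trans_lt h1
    refine ⟨ρ⁻¹, (one_lt_inv₀ hρ).2 h2, hg.comp (by fun_prop) fun ζ hζ => ?_⟩
    rw [mem_ball_zero_iff] at hζ ⊢
    rw [norm_smul]
    calc ‖ζ‖ * ‖z‖ ≤ ρ⁻¹ * ‖z‖ := by gcongr
      _ < ρ⁻¹ * ρ := by gcongr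
      _ = 1 := inv_mul_cancel₀ hρ.ne'
  have hrotmem : ∀ (θ : ℝ), ∀ z ∈ ball (0 : EuclideanSpace ℂ ι) 1,
      circleMap 0 1 θ • z ∈ ball (0 : EuclideanSpace ℂ ι) 1 := by
    intro θ z hz
    rw [mem_ball_zero_iff] at hz ⊢
    rw [norm_smul]; simpa using hz
  have hcoef : ∀ d, ∀ z ∈ ball (0 : EuclideanSpace ℂ ι) 1,
      ∫ θ, conj (circleMap 0 1 θ ^ d) * G (circleMap 0 1 θ • z) ∂τ =
        2 * Real.pi * ((d.factorial : ℂ)⁻¹ * MvPolynomial.eval (fun i => z i) (p d)) := by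
    intro d z hz
    obtain ⟨R, hR, hd⟩ := hslice z hz
    rw [← hpz, ← circleIntegral_taylor hR hd]
    refine integral_congr_ae (Eventually.of_forall fun θ => ?_)
    simp only [hGg _ (hrotmem θ z hz)]
  have hzero : ∀ d, ∀ᵐ z ∂μ, MvPolynomial.eval (fun i => z i) (p d) = 0 := by
    intro d
    set P : EuclideanSpace ℂ ι → ℂ := fun z => MvPolynomial.eval (fun i => z i) (p d) with hP
    have hPc : Continuous P := continuous_eval _
    -- orthogonality to `P`, transported by the rotation `z ↦ e^{iθ} z`, as `P` is homogeneous
    have hrot : ∀ θ, ∫ z, conj (P z) * (conj (circleMap 0 1 θ ^ d) * G (circleMap 0 1 θ • z)) ∂μ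
        = 0 := by
      intro θ
      have h0 : ∫ z, conj (P z) * G z ∂μ = 0 := by
        rw [← hf (p d), inner_eq_integral]
        refine integral_congr_ae ?_
        filter_upwards [toL2_polyVec (lam := lam) (p d), hfG] with z h1 h2
        rw [h1, h2]
      have hc : (Circle.exp θ : ℂ) = circleMap 0 1 θ := by simp [circleMap]
      have h1 := (measurePreserving_weightedVolume lam (circleRot ι (Circle.exp θ))).integral_comp
        (circleRot ι (Circle.exp θ)).toHomeomorph.measurableEmbedding (fun z => conj (P z) * G z)
      rw [h0] at h1
      refine Eq.trans (integral_congr_ae (Eventually.of_forall fun z => ?_)) h1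
      have h2 : circleRot ι (Circle.exp θ) z = circleMap 0 1 θ • z := by rw [← hc]; rfl
      simp only [h2]
      have h3 : P (circleMap 0 1 θ • z) = circleMap 0 1 θ ^ d * P z := by
        simp only [hP]
        simp only [MvPolynomial.eval_eq', PiLp.smul_apply, smul_eq_mul, mul_pow,
          Finset.prod_mul_distrib, Finset.mul_sum]
        refine Finset.sum_congr rfl fun s hs => ?_
        have hdeg := hp d (MvPolynomial.mem_support_iff.1 hs)
        rw [Finset.prod_pow_eq_pow_sum]
        have : ∑ i, s i = d := by
          rw [← hdeg, Finsupp.weight_apply, Finsupp.sum_fintype _ _ (by simp)]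
          simp
        rw [this]; ring
      rw [h3, map_mul]; ring
    have hint : Integrable (fun x : EuclideanSpace ℂ ι × ℝ =>
        conj (P x.1) * (conj (circleMap 0 1 x.2 ^ d) * G (circleMap 0 1 x.2 • x.1)))
        (μ.prod τ) := by
      have hGint : Integrable (fun x : EuclideanSpace ℂ ι × ℝ => G (circleMap 0 1 x.2 • x.1))
          (μ.prod τ) := by
        have hmeas : Measurable fun x : EuclideanSpace ℂ ι × ℝ => G (circleMap 0 1 x.2 • x.1) := by
          refine hGm.comp ?_
          exact (((continuous_circleMap 0 1).comp continuous_snd).smul continuous_fst).measurable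
        refine (integrable_prod_iff' hmeas.aestronglyMeasurable).2 ⟨?_, ?_⟩
        · refine Eventually.of_forall fun θ => ?_
          have hc : (Circle.exp θ : ℂ) = circleMap 0 1 θ := by simp [circleMap]
          have := (measurePreserving_weightedVolume lam
            (circleRot ι (Circle.exp θ))).integrable_comp_of_integrable hG1
          simp only [← hc]; exact this
        · have : ∀ θ, ∫ z, ‖G (circleMap 0 1 θ • z)‖ ∂μ = ∫ z, ‖G z‖ ∂μ := by
            intro θ
            have hc : (Circle.exp θ : ℂ) = circleMap 0 1 θ := by simp [circleMap]
            rw [← (measurePreserving_weightedVolume lam (circleRot ι (Circle.exp θ))).integral_comp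
              (circleRot ι (Circle.exp θ)).toHomeomorph.measurableEmbedding (fun z => ‖G z‖), ← hc]
            rfl
          simp only [this]
          exact integrable_const _
      obtain ⟨M, hM⟩ := exists_bound_eval (lam := lam) (p d)
      simp_rw [← mul_assoc]
      refine hGint.bdd_mul (c := M) ?_ ?_
      · refine Continuous.aestronglyMeasurable ?_
        have : Continuous fun x : EuclideanSpace ℂ ι × ℝ => circleMap 0 1 x.2 :=
          (continuous_circleMap 0 1).comp continuous_snd
        exact (Complex.continuous_conj.comp (hPc.comp continuous_fst)).mul
          (Complex.continuous_conj.comp (this.pow d))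
      · have := Measure.quasiMeasurePreserving_fst (μ := μ) (ν := τ) |>.ae hM
        filter_upwards [this] with x hx
        simpa using hx
    -- averaged over `θ`, this is the squared norm of `P`, up to a constant
    have h1 : ∫ z, conj (P z) * ∫ θ, conj (circleMap 0 1 θ ^ d) * G (circleMap 0 1 θ • z) ∂τ ∂μ
        = 0 := by
      simp_rw [← integral_const_mul]
      rw [integral_integral_swap hint]
      simp only [hrot, integral_zero]
    have h2 : ∫ z, ‖P z‖ ^ 2 ∂μ = 0 := by
      have h3 : ∫ z, conj (P z) * ∫ θ, conj (circleMap 0 1 θ ^ d) * G (circleMap 0 1 θ • z) ∂τ ∂μ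
          = ∫ z, (2 * Real.pi * (d.factorial : ℂ)⁻¹) * ((‖P z‖ ^ 2 : ℝ) : ℂ) ∂μ := by
        refine integral_congr_ae ?_
        filter_upwards [ae_mem_ball lam] with z hz
        rw [hcoef d z hz]
        push_cast
        rw [← Complex.conj_mul']
        ring
      rw [h1, integral_const_mul, integral_complex_ofReal] at h3
      have hfac : (d.factorial : ℂ) ≠ 0 := by exact_mod_cast d.factorial_ne_zero
      have h4 : (2 * Real.pi * (d.factorial : ℂ)⁻¹) ≠ 0 := by simp [hpi, hfac]
      exact_mod_cast (mul_eq_zero.1 h3.symm).resolve_left h4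
    have h5 : Integrable (fun z => ‖P z‖ ^ 2) μ :=
      (memLp_two_iff_integrable_sq_norm hPc.aestronglyMeasurable).1 (memLp_eval (p d) 2)
    have h6 := (integral_eq_zero_iff_of_nonneg (fun z => by positivity) h5).1 h2
    filter_upwards [h6] with z hz
    simpa using hz
  -- on every complex line through the origin, `g` is the sum of its Taylor series
  have hG0 : G =ᵐ[μ] 0 := by
    filter_upwards [ae_all_iff.2 hzero, ae_mem_ball lam] with z h1 h2
    obtain ⟨R, hR, hd⟩ := hslice z h2
    have h3 := Complex.hasSum_taylorSeries_on_ball hd (z := 1) (by simpa using hR)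
    simp only [hpz, h1, smul_zero] at h3
    rw [hGg z h2]
    simpa using h3.unique hasSum_zero
  have : toL2 lam f = 0 := by
    refine Lp.ext ?_
    filter_upwards [hfG, hG0, Lp.coeFn_zero ℂ 2 μ] with z h1 h2 h3
    rw [h1, h2, h3]
  exact (toL2 lam).injective (by simpa using this)

end Polynomial

/-! ### Composition with unitary maps -/

section Rotation

variable {ι : Type*} [Fintype ι] {lam : ℝ}

theorem bergman_ext {f g : BergmanSpace ι lam}
    (h : toL2 lam f =ᵐ[weightedVolume ι lam] toL2 lam g) : f = g :=
  (toL2 lam).injective (Lp.ext h)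

/-- The composition operator `f ↦ f ∘ e` on the Bergman space, for a unitary map `e` of `ℂⁿ`. -/
noncomputable def rot (lam : ℝ) (e : EuclideanSpace ℂ ι ≃ₗᵢ[ℂ] EuclideanSpace ℂ ι) :
    BergmanSpace ι lam →L[ℂ] BergmanSpace ι lam :=
  ((Lp.compMeasurePreservingₗᵢ ℂ e
    (measurePreserving_weightedVolume lam e)).toContinuousLinearMap ∘L
    (bergmanSubmodule ι lam).subtypeL).codRestrict (bergmanSubmodule ι lam) <| by
      rintro ⟨f, g, hg, hfg⟩
      refine ⟨g ∘ e, hg.comp e.differentiable.differentiableOn fun z hz => ?_, ?_⟩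
      · rw [mem_ball_zero_iff] at hz ⊢
        rwa [e.norm_map]
      · exact (Lp.coeFn_compMeasurePreserving f (measurePreserving_weightedVolume lam e)).trans
          ((measurePreserving_weightedVolume lam e).quasiMeasurePreserving.ae_eq_comp hfg)

variable (e e' : EuclideanSpace ℂ ι ≃ₗᵢ[ℂ] EuclideanSpace ℂ ι)

theorem toL2_rot (f : BergmanSpace ι lam) :
    toL2 lam (rot lam e f) =ᵐ[weightedVolume ι lam] toL2 lam f ∘ e :=
  Lp.coeFn_compMeasurePreserving (toL2 lam f) (measurePreserving_weightedVolume lam e)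

theorem inner_rot (f g : BergmanSpace ι lam) :
    inner ℂ (rot lam e f) (rot lam e g) = inner ℂ f g :=
  (Lp.compMeasurePreservingₗᵢ ℂ e (measurePreserving_weightedVolume lam e)).inner_map_map
    (toL2 lam f) (toL2 lam g)

theorem toL2_rot_rot (f : BergmanSpace ι lam) :
    toL2 lam (rot lam e (rot lam e' f)) =ᵐ[weightedVolume ι lam]
      fun z => toL2 lam f (e' (e z)) := by
  have h := (measurePreserving_weightedVolume lam e).quasiMeasurePreserving.ae (toL2_rot e' f)
  filter_upwards [toL2_rot e (rot lam e' f), h] with z h1 h2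
  rw [h1, Function.comp_apply, h2, Function.comp_apply]

theorem rot_rot_symm (f : BergmanSpace ι lam) : rot lam e (rot lam e.symm f) = f := by
  refine bergman_ext ((toL2_rot_rot e e.symm f).trans ?_)
  simp

theorem rot_commute (h : ∀ z, e (e' z) = e' (e z)) : Commute (rot lam e) (rot lam e') := by
  refine ContinuousLinearMap.ext fun f => bergman_ext ?_
  refine (toL2_rot_rot e e' f).trans (EventuallyEq.trans ?_ (toL2_rot_rot e' e f).symm)
  simp [h]

theorem rot_polyVec [IsFiniteMeasure (weightedVolume ι lam)] {p q : MvPolynomial ι ℂ}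
    (h : ∀ z, MvPolynomial.eval (fun i => e z i) p = MvPolynomial.eval (fun i => z i) q) :
    rot lam e (polyVec lam p) = polyVec lam q := by
  refine bergman_ext ((toL2_rot e _).trans ?_)
  refine ((measurePreserving_weightedVolume lam e).quasiMeasurePreserving.ae_eq_comp
    (toL2_polyVec p)).trans (EventuallyEq.trans ?_ (toL2_polyVec q).symm)
  exact Eventually.of_forall h

/-- A sesquilinear form of the Toeplitz operator: the Bergman projection disappears. -/
theorem inner_toeplitz (a : SymbolSpace ι) (f g : BergmanSpace ι lam) :
    inner ℂ g (toeplitz lam a f) =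
      ∫ z, conj (toL2 lam g z) * (a z * toL2 lam f z) ∂weightedVolume ι lam := by
  have h1 : inner ℂ g (toeplitz lam a f) = inner ℂ (toL2 lam g) (mulOperator lam a (toL2 lam f)) :=
    Submodule.inner_orthogonalProjectionOnto_eq_of_mem_left (K := bergmanSubmodule ι lam) g
      (mulOperator lam a (toL2 lam f))
  rw [h1, L2.inner_def]
  refine integral_congr_ae ?_
  have h2 : mulOperator lam a (toL2 lam f) =ᵐ[weightedVolume ι lam]
      fun z => weightedSymbol lam a z * toL2 lam f z :=
    (ContinuousLinearMap.mul ℂ ℂ).coeFn_holder (r := 2) (weightedSymbol lam a) (toL2 lam f)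
  have h3 : weightedSymbol lam a =ᵐ[weightedVolume ι lam] a := MemLp.coeFn_toLp _
  filter_upwards [h2, h3] with z hz hz'
  rw [hz, hz', RCLike.inner_apply, mul_comm]

theorem toeplitz_commute_rot {a : SymbolSpace ι}
    (ha : (fun z => a (e z)) =ᵐ[volume.restrict (ball (0 : EuclideanSpace ℂ ι) 1)] a) :
    Commute (toeplitz lam a) (rot lam e) := by
  refine ContinuousLinearMap.ext fun f => ext_inner_left ℂ fun g => ?_
  change inner ℂ g (toeplitz lam a (rot lam e f)) = inner ℂ g (rot lam e (toeplitz lam a f))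
  have hg := rot_rot_symm e g
  rw [← hg, inner_rot, inner_toeplitz, inner_toeplitz]
  have h1 := (measurePreserving_weightedVolume lam e).integral_comp
    e.toHomeomorph.measurableEmbedding
    (fun z => conj (toL2 lam (rot lam e.symm g) z) * (a z * toL2 lam f z))
  rw [← h1]
  refine integral_congr_ae ?_
  filter_upwards [toL2_rot e (rot lam e.symm g), toL2_rot e f, (weightedVolume_ac lam).ae_le ha]
    with z h2 h3 h4
  rw [h2, h3, ← h4]
  rfl

end Rotation

/-! ### Unitary matrices and invariant symbols -/

section Unitary

variable {ι : Type*} [Fintype ι] [DecidableEq ι]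

/-- A unitary matrix, as a linear isometry of `ℂⁿ`. -/
noncomputable def unitaryIso (A : Matrix.unitaryGroup ι ℂ) :
    EuclideanSpace ℂ ι ≃ₗᵢ[ℂ] EuclideanSpace ℂ ι :=
  { toLinearEquiv := LinearEquiv.ofLinearMap (Matrix.toEuclideanLin (A : Matrix ι ι ℂ))
      (Matrix.toEuclideanLin (star (A : Matrix ι ι ℂ)))
      (by
        ext1 z
        simp [Matrix.toLpLin_apply])
      (by
        ext1 z
        simp [Matrix.toLpLin_apply])
    norm_map' := fun z => by
      change ‖Matrix.toEuclideanLin (A : Matrix ι ι ℂ) z‖ = ‖z‖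
      have h : inner ℂ (Matrix.toEuclideanLin (A : Matrix ι ι ℂ) z)
          (Matrix.toEuclideanLin (A : Matrix ι ι ℂ) z) = inner ℂ z z := by
        have hA : star (A : Matrix ι ι ℂ) * A = 1 := Matrix.mem_unitaryGroup_iff'.1 A.2
        rw [← LinearMap.adjoint_inner_left, ← Matrix.toEuclideanLin_conjTranspose_eq_adjoint,
          ← Matrix.star_eq_conjTranspose]
        simp only [Matrix.toLpLin_apply, Matrix.mulVec_mulVec, hA, Matrix.one_mulVec]
      rw [inner_self_eq_norm_sq_to_K, inner_self_eq_norm_sq_to_K] at h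
      have h' : ‖Matrix.toEuclideanLin (A : Matrix ι ι ℂ) z‖ ^ 2 = ‖z‖ ^ 2 := by exact_mod_cast h
      exact (sq_eq_sq₀ (norm_nonneg _) (norm_nonneg _)).1 h' }

theorem unitaryIso_apply (A : Matrix.unitaryGroup ι ℂ) (z : EuclideanSpace ℂ ι) (i : ι) :
    unitaryIso A z i = ∑ j, (A : Matrix ι ι ℂ) i j * z j := rfl

theorem unitaryIso_mul_apply (A B : Matrix.unitaryGroup ι ℂ) (z : EuclideanSpace ℂ ι) :
    unitaryIso (A * B) z = unitaryIso A (unitaryIso B z) := by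
  change Matrix.toEuclideanLin ((A : Matrix ι ι ℂ) * (B : Matrix ι ι ℂ)) z =
    Matrix.toEuclideanLin (A : Matrix ι ι ℂ) (Matrix.toEuclideanLin (B : Matrix ι ι ℂ) z)
  simp [Matrix.toLpLin_apply]

theorem rot_unitaryIso_commute {lam : ℝ} {A B : Matrix.unitaryGroup ι ℂ} (h : Commute A B) :
    Commute (rot lam (unitaryIso A)) (rot lam (unitaryIso B)) :=
  rot_commute _ _ fun z => by rw [← unitaryIso_mul_apply, h.eq, unitaryIso_mul_apply]

theorem IsInvariant.commute_rot {lam : ℝ} {H : Subgroup (Matrix.unitaryGroup ι ℂ)}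
    {a : SymbolSpace ι} (ha : IsInvariant H a) {A : Matrix.unitaryGroup ι ℂ} (hA : A ∈ H) :
    Commute (toeplitz lam a) (rot lam (unitaryIso A)) :=
  toeplitz_commute_rot _ (ha A hA)

end Unitary

/-! ### Monomials and operators commuting with diagonal matrices -/

section Monomial

variable {ι : Type*} [Fintype ι]

/-- The monomial `z ^ α`, as an element of the Bergman space. -/
noncomputable def mono (lam : ℝ) [IsFiniteMeasure (weightedVolume ι lam)] (α : ι → ℕ) :
    BergmanSpace ι lam :=
  polyVec lam (∏ i, MvPolynomial.X i ^ α i)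

variable {lam : ℝ} [IsFiniteMeasure (weightedVolume ι lam)]

theorem eq_zero_of_inner_mono {f : BergmanSpace ι lam} (hf : ∀ α, inner ℂ (mono lam α) f = 0) :
    f = 0 := by
  refine eq_zero_of_inner_polyVec fun p => ?_
  rw [p.as_sum, map_sum, sum_inner]
  refine Finset.sum_eq_zero fun s _ => ?_
  have h : MvPolynomial.monomial s (p.coeff s) =
      p.coeff s • ∏ i, (MvPolynomial.X i : MvPolynomial ι ℂ) ^ s i := by
    rw [MvPolynomial.monomial_eq, MvPolynomial.smul_eq_C_mul, Finsupp.prod_fintype _ _ (by simp)]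
  rw [h, map_smul, inner_smul_left]
  exact mul_eq_zero_of_right _ (hf s)

theorem topologicalClosure_span_mono :
    (Submodule.span ℂ (Set.range (mono (ι := ι) lam))).topologicalClosure = ⊤ := by
  rw [Submodule.topologicalClosure_eq_top_iff, Submodule.eq_bot_iff]
  intro f hf
  exact eq_zero_of_inner_mono fun α =>
    (Submodule.mem_orthogonal _ _).1 hf _ (Submodule.subset_span ⟨α, rfl⟩)

theorem ext_mono {S T : BergmanSpace ι lam →L[ℂ] BergmanSpace ι lam}
    (h : ∀ α, S (mono lam α) = T (mono lam α)) : S = T := by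
  refine ContinuousLinearMap.ext_on (s := Set.range (mono (ι := ι) lam)) ?_ ?_
  · rw [Submodule.dense_iff_topologicalClosure_eq_top]
    exact topologicalClosure_span_mono
  · rintro _ ⟨α, rfl⟩
    exact h α

variable [DecidableEq ι]

/-- The diagonal unitary matrix with diagonal entries `t`. -/
noncomputable def diagUnitary (t : ι → Circle) : Matrix.unitaryGroup ι ℂ :=
  ⟨Matrix.diagonal fun i => (t i : ℂ), by
    rw [Matrix.mem_unitaryGroup_iff, Matrix.star_eq_conjTranspose, Matrix.diagonal_conjTranspose,
      Matrix.diagonal_mul_diagonal, ← Matrix.diagonal_one]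
    congr 1
    ext i
    change (t i : ℂ) * conj (t i : ℂ) = 1
    rw [Complex.mul_conj', Circle.norm_coe]
    simp⟩

theorem rot_diagUnitary_mono (t : ι → Circle) (α : ι → ℕ) :
    rot lam (unitaryIso (diagUnitary t)) (mono lam α) =
      ((∏ i, t i ^ α i : Circle) : ℂ) • mono lam α := by
  rw [mono, ← map_smul]
  refine rot_polyVec _ fun z => ?_
  have : ∀ i, unitaryIso (diagUnitary t) z i = t i * z i := by
    intro i
    rw [unitaryIso_apply]
    simp [diagUnitary, Matrix.diagonal_apply]
  have hc : ((∏ i, t i ^ α i : Circle) : ℂ) = ∏ i, (t i : ℂ) ^ α i := by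
    refine (map_prod Circle.coeHom _ _).trans ?_
    simp only [map_pow]
    rfl
  simp [this, mul_pow, Finset.prod_mul_distrib, MvPolynomial.smul_eval, hc]

theorem inner_mono_eq_zero {T : BergmanSpace ι lam →L[ℂ] BergmanSpace ι lam} {t : ι → Circle}
    (hT : Commute T (rot lam (unitaryIso (diagUnitary t)))) {α β : ι → ℕ}
    (h : ∏ i, t i ^ α i ≠ ∏ i, t i ^ β i) : inner ℂ (mono lam β) (T (mono lam α)) = 0 := by
  set R := rot lam (unitaryIso (diagUnitary t)) with hR
  have h1 : T (R (mono lam α)) = R (T (mono lam α)) := DFunLike.congr_fun hT.eq _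
  have h2 := inner_rot (lam := lam) (unitaryIso (diagUnitary t)) (mono lam β) (T (mono lam α))
  rw [← hR, ← h1, hR, rot_diagUnitary_mono, rot_diagUnitary_mono, map_smul, inner_smul_left,
    inner_smul_right, ← mul_assoc] at h2
  by_contra h0
  have h3 := mul_right_cancel₀ h0 (h2.trans (one_mul _).symm)
  rw [← Circle.coe_inv_eq_conj, ← Circle.coe_mul] at h3
  have h4 : (∏ i, t i ^ β i)⁻¹ * ∏ i, t i ^ α i = 1 := Circle.ext (by simpa using h3)
  exact h (inv_mul_eq_one.1 h4).symm

theorem exists_circle_pow_ne {a b : ℕ} (h : a ≠ b) : ∃ c : Circle, c ^ a ≠ c ^ b := by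
  refine ⟨Circle.exp 1, fun h1 => ?_⟩
  have h2 : ∀ n : ℕ, Circle.exp 1 ^ n = Circle.exp n := fun n => by
    induction n with
    | zero => simp
    | succ n ih => rw [pow_succ, ih, ← Circle.exp_add]; simp
  rw [h2, h2, Circle.exp_eq_exp] at h1
  obtain ⟨m, hm⟩ := h1
  have hm0 : m ≠ 0 := by
    rintro rfl
    exact h (by exact_mod_cast (by simpa using hm : (a : ℝ) = b))
  refine irrational_pi ⟨((a : ℤ) - b) / (2 * m), ?_⟩
  have : (m : ℝ) ≠ 0 := by exact_mod_cast hm0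
  push_cast
  rw [hm]
  field_simp
  ring

theorem prod_single_pow (q : ι) (c : Circle) (α : ι → ℕ) :
    ∏ i, (Pi.mulSingle q c : ι → Circle) i ^ α i = c ^ α q := by
  rw [Finset.prod_eq_single q] <;> simp +contextual [Pi.mulSingle_eq_of_ne]

theorem inner_mono_mono {α β : ι → ℕ} (h : β ≠ α) :
    inner ℂ (mono lam β) (mono lam α) = 0 := by
  obtain ⟨q, hq⟩ := Function.ne_iff.1 h.symm
  obtain ⟨c, hc⟩ := exists_circle_pow_ne hq
  refine inner_mono_eq_zero (T := 1) (t := Pi.mulSingle q c) (Commute.one_left _) ?_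
  rwa [prod_single_pow, prod_single_pow]

/-- A vector orthogonal to all but finitely many monomials is a combination of these. -/
theorem mem_span_mono {F : Set (ι → ℕ)} (hF : F.Finite) {y : BergmanSpace ι lam}
    (hy : ∀ β, β ∉ F → inner ℂ (mono lam β) y = 0) : y ∈ Submodule.span ℂ (mono lam '' F) := by
  set K := Submodule.span ℂ (mono (ι := ι) lam '' F) with hK
  have : FiniteDimensional ℂ K := FiniteDimensional.span_of_finite ℂ (hF.image _)
  have h0 : y - K.starProjection y = 0 := by
    refine eq_zero_of_inner_mono fun β => ?_
    by_cases hβ : β ∈ F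
    · exact (Submodule.mem_orthogonal _ _).1 (K.sub_starProjection_mem_orthogonal y) _
        (Submodule.subset_span ⟨β, hβ, rfl⟩)
    · rw [inner_sub_right, hy β hβ, zero_sub, neg_eq_zero]
      have h1 : K ≤ (Submodule.span ℂ {mono lam β})ᗮ := by
        rw [hK, Submodule.span_le]
        rintro _ ⟨α, hα, rfl⟩
        rw [SetLike.mem_coe, Submodule.mem_orthogonal_singleton_iff_inner_right]
        exact inner_mono_mono fun h => hβ (h ▸ hα)
      exact (Submodule.mem_orthogonal_singleton_iff_inner_right).1
        (h1 (K.starProjection_apply_mem y))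
  rw [sub_eq_zero.1 h0]
  exact K.starProjection_apply_mem y

end Monomial

/-! ### Polarization -/

section Polarization

/-- Polarization: every monomial of degree `d` is a combination of `d`-th powers of linear forms
`⟨z, u⟩` with unit vectors `u`. A linear functional which annihilates these powers gives, by the
multinomial theorem, a polynomial in `u` which vanishes, and its coefficients are, up to multinomial
coefficients, the values of the functional on the monomials. -/
theorem monomial_mem_span_pow {κ : Type*} [Fintype κ] [Nonempty κ] (γ : κ → ℕ) :
    (∏ p, (MvPolynomial.X p : MvPolynomial κ ℂ) ^ γ p) ∈
      Submodule.span ℂ {q : MvPolynomial κ ℂ | ∃ u : EuclideanSpace ℂ κ, ‖u‖ = 1 ∧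
        q = (∑ p, MvPolynomial.C (u p) * MvPolynomial.X p) ^ ∑ p, γ p} := by
  classical
  by_contra hcon
  obtain ⟨φ, hφ, hW⟩ := Submodule.exists_le_ker_of_notMem hcon
  set d := ∑ p, γ p with hd
  set Q : MvPolynomial κ ℂ := ∑ δ ∈ Finset.piAntidiag Finset.univ d,
    MvPolynomial.monomial (Finsupp.equivFunOnFinite.symm δ)
      ((Nat.multinomial Finset.univ δ : ℂ) * φ (∏ p, MvPolynomial.X p ^ δ p)) with hQ
  have hQe : ∀ u : κ → ℂ, MvPolynomial.eval u Q =
      φ ((∑ p, MvPolynomial.C (u p) * MvPolynomial.X p) ^ d) := by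
    intro u
    rw [Finset.sum_pow_eq_sum_piAntidiag, hQ, map_sum, map_sum]
    refine Finset.sum_congr rfl fun δ _ => ?_
    have h1 : (Nat.multinomial Finset.univ δ : MvPolynomial κ ℂ) *
        ∏ p, (MvPolynomial.C (u p) * MvPolynomial.X p) ^ δ p =
        ((Nat.multinomial Finset.univ δ : ℂ) * ∏ p, u p ^ δ p) • ∏ p, MvPolynomial.X p ^ δ p := by
      simp only [mul_pow, Finset.prod_mul_distrib, MvPolynomial.smul_eq_C_mul, map_mul, map_prod,
        map_pow, map_natCast]
      ring
    rw [h1, map_smul, MvPolynomial.eval_monomial, Finsupp.prod_fintype _ _ (by simp), smul_eq_mul]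
    simp only [Finsupp.equivFunOnFinite_symm_apply_apply]
    ring
  have hQ0 : Q = 0 := by
    refine MvPolynomial.funext_set (fun _ => {x : ℂ | x ≠ 0}) (fun _ => ?_) fun u hu => ?_
    · exact (Set.finite_singleton (0 : ℂ)).infinite_compl
    · rw [map_zero, hQe]
      set U : EuclideanSpace ℂ κ := WithLp.toLp 2 u with hU
      have hU0 : U ≠ 0 := by
        intro h
        obtain ⟨p⟩ := ‹Nonempty κ›
        refine hu p (Set.mem_univ p) ?_
        have := congrArg (fun v : EuclideanSpace ℂ κ => v p) h
        simpa [hU] using this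
      have hn : (‖U‖ : ℂ) ≠ 0 := by simpa using hU0
      have h1 : ((∑ p, MvPolynomial.C (u p) * MvPolynomial.X p) ^ d : MvPolynomial κ ℂ) =
          ((‖U‖ : ℂ) ^ d) • (∑ p, MvPolynomial.C (((‖U‖ : ℂ)⁻¹ • U) p) * MvPolynomial.X p) ^ d := by
        have h2 : (∑ p, MvPolynomial.C (u p) * MvPolynomial.X p : MvPolynomial κ ℂ) =
            MvPolynomial.C (‖U‖ : ℂ) *
              ∑ p, MvPolynomial.C (((‖U‖ : ℂ)⁻¹ • U) p) * MvPolynomial.X p := by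
          rw [Finset.mul_sum]
          refine Finset.sum_congr rfl fun p _ => ?_
          rw [← mul_assoc, ← map_mul]
          congr 2
          rw [PiLp.smul_apply, smul_eq_mul, mul_inv_cancel_left₀ hn]
        rw [h2, mul_pow, MvPolynomial.smul_eq_C_mul, map_pow]
      rw [h1, map_smul]
      have h3 : (∑ p, MvPolynomial.C (((‖U‖ : ℂ)⁻¹ • U) p) * MvPolynomial.X p) ^ d ∈
          LinearMap.ker φ := by
        refine hW (Submodule.subset_span ⟨(‖U‖ : ℂ)⁻¹ • U, ?_, rfl⟩)
        rw [norm_smul, norm_inv, Complex.norm_real, norm_norm, inv_mul_cancel₀]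
        simpa using hU0
      rw [LinearMap.mem_ker.1 h3, smul_zero]
  have hc := congrArg (MvPolynomial.coeff (Finsupp.equivFunOnFinite.symm γ)) hQ0
  rw [hQ, MvPolynomial.coeff_sum, Finset.sum_eq_single γ, MvPolynomial.coeff_monomial, if_pos rfl,
    MvPolynomial.coeff_zero] at hc
  · refine hφ ((mul_eq_zero.1 hc).resolve_left ?_)
    exact_mod_cast (Nat.multinomial_pos _ _).ne'
  · intro δ _ hδ
    rw [MvPolynomial.coeff_monomial, if_neg]
    exact fun h => hδ (Finsupp.equivFunOnFinite.symm.injective h)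
  · intro h
    exact absurd (by simp [Finset.mem_piAntidiag, hd]) h

/-- Every unit vector is a row of a unitary matrix. -/
theorem exists_unitary_row {κ : Type*} [Fintype κ] [DecidableEq κ] (p₀ : κ)
    {u : EuclideanSpace ℂ κ} (hu : ‖u‖ = 1) :
    ∃ B : Matrix.unitaryGroup κ ℂ, ∀ p, (B : Matrix κ κ ℂ) p₀ p = u p := by
  have hv : Orthonormal ℂ (({p₀} : Set κ).domRestrict fun _ => u) := by
    refine ⟨fun _ => hu, fun i j hij => (hij (Subsingleton.elim i j)).elim⟩
  obtain ⟨b, hb⟩ := hv.exists_orthonormalBasis_extension_of_card_eq (by simp)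
  refine ⟨⟨Matrix.of fun i p => b i p, ?_⟩, fun p => by simp [hb p₀ rfl]⟩
  rw [Matrix.mem_unitaryGroup_iff]
  ext i j
  have h := orthonormal_iff_ite.1 b.orthonormal j i
  rw [PiLp.inner_apply] at h
  rw [Matrix.mul_apply, Matrix.one_apply]
  simp only [RCLike.inner_apply] at h
  rw [Matrix.star_eq_conjTranspose]
  simp only [Matrix.conjTranspose_apply, Matrix.of_apply]
  simpa [eq_comm] using h

end Polarization

/-! ### Commutativity -/

section Block

variable {m : ℕ} {k : Fin m → ℕ}

theorem unitaryIso_blockDiag (B : ∀ j, Matrix.unitaryGroup (Fin (k j)) ℂ)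
    (z : EuclideanSpace ℂ (Coord k)) (i : Fin m) (p : Fin (k i)) :
    unitaryIso (blockDiag k B) z ⟨i, p⟩ =
      ∑ q, (B i : Matrix (Fin (k i)) (Fin (k i)) ℂ) p q * z ⟨i, q⟩ := by
  rw [unitaryIso_apply, Fintype.sum_sigma, Finset.sum_eq_single i]
  · refine Finset.sum_congr rfl fun q _ => ?_
    congr 1
    exact Matrix.blockDiagonal'_apply_eq (fun j => (B j : Matrix (Fin (k j)) (Fin (k j)) ℂ)) i p q
  · intro i' _ hi'
    refine Finset.sum_eq_zero fun q _ => ?_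
    have : (blockDiag k B : Matrix (Coord k) (Coord k) ℂ) ⟨i, p⟩ ⟨i', q⟩ = 0 :=
      Matrix.blockDiagonal'_apply_ne (fun j => (B j : Matrix (Fin (k j)) (Fin (k j)) ℂ)) p q
        hi'.symm
    rw [this, zero_mul]
  · simp

theorem blockDiag_mulSingle_mem {j l : Fin m} (h : j ≠ l)
    (B : Matrix.unitaryGroup (Fin (k j)) ℂ) :
    blockDiag k (Pi.mulSingle j B) ∈ blockUnitaryScalar k l := by
  refine ⟨_, ?_, rfl⟩
  change (Pi.mulSingle j B : ∀ j, Matrix.unitaryGroup (Fin (k j)) ℂ) l ∈ scalarUnitary (k l)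
  rw [Pi.mulSingle_eq_of_ne h.symm]
  exact one_mem _

theorem blockDiag_mulSingle_commute {j l : Fin m} (h : j ≠ l)
    (B : Matrix.unitaryGroup (Fin (k j)) ℂ) (C : Matrix.unitaryGroup (Fin (k l)) ℂ) :
    Commute (blockDiag k (Pi.mulSingle j B)) (blockDiag k (Pi.mulSingle l C)) :=
  (Pi.mulSingle_commute (f := fun j => Matrix.unitaryGroup (Fin (k j)) ℂ) h B C).map (blockDiag k)

/-- A diagonal matrix which is scalar on the block `j` lies in `U(k, j, 𝕋)`. -/
theorem diagUnitary_mem {j : Fin m} {t : Coord k → Circle} {c : Circle} (h : ∀ p, t ⟨j, p⟩ = c) :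
    diagUnitary t ∈ blockUnitaryScalar k j := by
  refine ⟨fun i => diagUnitary fun p => t ⟨i, p⟩, ⟨c, ?_⟩, ?_⟩
  · ext p q
    simp [diagUnitary, h, Matrix.diagonal_apply, Matrix.one_apply]
  · exact Subtype.ext (Matrix.blockDiagonal'_diagonal fun i p => (t ⟨i, p⟩ : ℂ))

/-- The multi-indices which agree with `α` off the block `j` and have the same degree as `α` in the
block `j`. -/
def blockClass (j : Fin m) (α : Coord k → ℕ) : Set (Coord k → ℕ) :=
  {β | (∀ q : Coord k, q.1 ≠ j → β q = α q) ∧ ∑ p, β ⟨j, p⟩ = ∑ p, α ⟨j, p⟩}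

theorem finite_blockClass (j : Fin m) (α : Coord k → ℕ) : (blockClass j α).Finite := by
  refine (Set.finite_Iic fun _ : Coord k => ∑ q, α q).subset fun β hβ q => ?_
  obtain ⟨i, p⟩ := q
  have hle : ∀ (γ : Coord k → ℕ) (i : Fin m), ∑ p, γ ⟨i, p⟩ ≤ ∑ q, γ q := fun γ i => by
    rw [Fintype.sum_sigma]
    exact Finset.single_le_sum (f := fun i => ∑ p, γ ⟨i, p⟩) (fun _ _ => Nat.zero_le _)
      (Finset.mem_univ i)
  by_cases hi : i = j
  · subst hi
    refine le_trans ?_ (hle α i)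
    rw [← hβ.2]
    exact Finset.single_le_sum (f := fun p => β ⟨i, p⟩) (fun _ _ => Nat.zero_le _)
      (Finset.mem_univ p)
  · rw [hβ.1 _ hi]
    exact Finset.single_le_sum (fun _ _ => Nat.zero_le _) (Finset.mem_univ _)

variable {lam : ℝ} [IsFiniteMeasure (weightedVolume (Coord k) lam)]

/-- An operator commuting with `U(k, j, 𝕋)` changes a monomial in the block `j` only, and there it
preserves the degree. -/
theorem apply_mono_mem_span {j : Fin m}
    {T : BergmanSpace (Coord k) lam →L[ℂ] BergmanSpace (Coord k) lam}
    (hT : ∀ A ∈ blockUnitaryScalar k j, Commute T (rot lam (unitaryIso A))) (α : Coord k → ℕ) :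
    T (mono lam α) ∈ Submodule.span ℂ (mono lam '' blockClass j α) := by
  classical
  refine mem_span_mono (finite_blockClass j α) fun β hβ => ?_
  by_cases h : ∀ q : Coord k, q.1 ≠ j → β q = α q
  · have hd : ∑ p, α ⟨j, p⟩ ≠ ∑ p, β ⟨j, p⟩ := fun hd => hβ ⟨h, hd.symm⟩
    obtain ⟨c, hc⟩ := exists_circle_pow_ne hd
    set t : Coord k → Circle := fun q => if q.1 = j then c else 1 with ht
    have hprod : ∀ γ : Coord k → ℕ, ∏ q, t q ^ γ q = c ^ ∑ p, γ ⟨j, p⟩ := by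
      intro γ
      rw [Fintype.prod_sigma, Finset.prod_eq_single j]
      · simp [ht, Finset.prod_pow_eq_pow_sum]
      · intro i _ hi
        simp [ht, hi]
      · simp
    refine inner_mono_eq_zero (hT _ (diagUnitary_mem (t := t) (c := c) fun p => by simp [ht])) ?_
    rwa [hprod, hprod]
  · push Not at h
    obtain ⟨q, hq, hne⟩ := h
    obtain ⟨c, hc⟩ := exists_circle_pow_ne hne.symm
    refine inner_mono_eq_zero
      (hT _ (diagUnitary_mem (t := Pi.mulSingle q c) (c := 1) fun p => ?_)) ?_
    · exact Pi.mulSingle_eq_of_ne (fun h => hq (by rw [← h])) _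
    · rwa [prod_single_pow, prod_single_pow]

/-- The multi-index `α` with its block `j` replaced by `(d, 0, …, 0)`, of the same degree `d`. -/
def concentrate (hk : ∀ j, 0 < k j) (j : Fin m) (α : Coord k → ℕ) : Coord k → ℕ := fun q =>
  if q.1 = j then (if q = ⟨j, ⟨0, hk j⟩⟩ then ∑ p, α ⟨j, p⟩ else 0) else α q

variable (hk : ∀ j, 0 < k j)

theorem concentrate_of_mem_blockClass {j : Fin m} {α β : Coord k → ℕ} (h : β ∈ blockClass j α) :
    concentrate hk j β = concentrate hk j α := by
  ext q
  by_cases hq : q.1 = j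
  · simp [concentrate, hq, h.2]
  · simp [concentrate, hq, h.1 q hq]

theorem concentrate_apply_of_ne {j : Fin m} {q : Coord k} (hq : q.1 ≠ j) (α : Coord k → ℕ) :
    concentrate hk j α q = α q := if_neg hq

theorem concentrate_comm {j l : Fin m} (h : j ≠ l) (α : Coord k → ℕ) :
    concentrate hk j (concentrate hk l α) = concentrate hk l (concentrate hk j α) := by
  ext q
  by_cases hj : q.1 = j
  · have hl : q.1 ≠ l := fun hl => h (hj.symm.trans hl)
    rw [concentrate_apply_of_ne hk hl]
    simp only [concentrate, hj, if_true, h, if_false]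
  · rw [concentrate_apply_of_ne hk hj]
    by_cases hl : q.1 = l
    · simp only [concentrate, hl, if_true, h.symm, if_false]
    · rw [concentrate_apply_of_ne hk hl, concentrate_apply_of_ne hk hl,
        concentrate_apply_of_ne hk hj]

/-- The monomials with a given block `j` are obtained from the concentrated ones by a combination of
rotations of the block `j` which does not depend on the other blocks. -/
theorem exists_apply_mono_concentrate (lam : ℝ) [IsFiniteMeasure (weightedVolume (Coord k) lam)]
    (j : Fin m) (γ : Fin (k j) → ℕ) :
    ∃ X : BergmanSpace (Coord k) lam →L[ℂ] BergmanSpace (Coord k) lam,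
      (∀ S : BergmanSpace (Coord k) lam →L[ℂ] BergmanSpace (Coord k) lam,
        (∀ B, Commute S (rot lam (unitaryIso (blockDiag k (Pi.mulSingle j B))))) → Commute S X) ∧
      ∀ β : Coord k → ℕ, (∀ p, β ⟨j, p⟩ = γ p) →
        X (mono lam (concentrate hk j β)) = mono lam β := by
  classical
  have : Nonempty (Fin (k j)) := ⟨⟨0, hk j⟩⟩
  obtain ⟨N, c, g, hg⟩ := Submodule.mem_span_set'.1 (monomial_mem_span_pow γ)
  choose u hu hgu using fun i => (g i).2
  choose B hB using fun i => exists_unitary_row (⟨0, hk j⟩ : Fin (k j)) (hu i)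
  refine ⟨∑ i, c i • rot lam (unitaryIso (blockDiag k (Pi.mulSingle j (B i)))), fun S hS => ?_,
    fun β hβ => ?_⟩
  · exact Commute.sum_right _ _ _ fun i _ => (hS (B i)).smul_right (c i)
  set R : MvPolynomial (Coord k) ℂ :=
    ∏ i ∈ Finset.univ.erase j, ∏ p, MvPolynomial.X ⟨i, p⟩ ^ β ⟨i, p⟩ with hR
  have h1 : ∀ i, rot lam (unitaryIso (blockDiag k (Pi.mulSingle j (B i))))
      (mono lam (concentrate hk j β)) =
        polyVec lam (MvPolynomial.rename (Sigma.mk j) (g i : MvPolynomial (Fin (k j)) ℂ) * R) := by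
    intro i
    refine rot_polyVec _ fun z => ?_
    rw [hgu i]
    simp only [map_prod, map_pow, MvPolynomial.eval_X, map_mul, map_sum, MvPolynomial.rename_C,
      MvPolynomial.rename_X, MvPolynomial.eval_C, hR]
    rw [Fintype.prod_sigma, ← Finset.mul_prod_erase _ _ (Finset.mem_univ j)]
    congr 1
    · rw [Finset.prod_eq_single (⟨0, hk j⟩ : Fin (k j))]
      · rw [unitaryIso_blockDiag, Pi.mulSingle_eq_same]
        simp only [hB, concentrate, if_true, hβ]
      · intro p _ hp
        simp [concentrate, hp]
      · simp
    · refine Finset.prod_congr rfl fun i' hi' => Finset.prod_congr rfl fun p _ => ?_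
      have hne : i' ≠ j := (Finset.mem_erase.1 hi').1
      rw [concentrate_apply_of_ne hk hne, unitaryIso_blockDiag, Pi.mulSingle_eq_of_ne hne]
      simp [Matrix.one_apply]
  rw [sum_apply]
  simp only [smul_apply, h1]
  simp only [← map_smul, ← map_sum, ← smul_mul_assoc, ← Finset.sum_mul]
  rw [hg, mono]
  congr 1
  rw [Fintype.prod_sigma, ← Finset.mul_prod_erase _ _ (Finset.mem_univ j)]
  simp only [map_prod, map_pow, MvPolynomial.rename_X, hβ, hR]

/-- If `T` commutes with `U(k, j, 𝕋)`, then the image under `T` of a monomial is obtained from the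
monomial with its block `j` concentrated by a combination of the operators `X γ`, which produce all
monomials from the concentrated ones. -/
theorem exists_apply_concentrate_eq {j : Fin m}
    {T : BergmanSpace (Coord k) lam →L[ℂ] BergmanSpace (Coord k) lam}
    (hT : ∀ A ∈ blockUnitaryScalar k j, Commute T (rot lam (unitaryIso A)))
    {X : (Fin (k j) → ℕ) → BergmanSpace (Coord k) lam →L[ℂ] BergmanSpace (Coord k) lam}
    (hX : ∀ γ, ∀ β : Coord k → ℕ, (∀ p, β ⟨j, p⟩ = γ p) →
        X γ (mono lam (concentrate hk j β)) = mono lam β) (α : Coord k → ℕ) :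
    ∃ X' : BergmanSpace (Coord k) lam →L[ℂ] BergmanSpace (Coord k) lam,
      X' (mono lam (concentrate hk j α)) = T (mono lam α) ∧
      ∀ Z, (∀ γ, Commute Z (X γ)) → Commute Z X' := by
  have hmem := apply_mono_mem_span hT α
  generalize T (mono lam α) = y at hmem
  induction hmem using Submodule.span_induction with
  | mem w hw =>
    obtain ⟨β, hβ, rfl⟩ := hw
    refine ⟨X fun p => β ⟨j, p⟩, ?_, fun Z hZ => hZ _⟩
    rw [← concentrate_of_mem_blockClass hk hβ]
    exact hX _ _ fun _ => rfl
  | zero => exact ⟨0, rfl, fun _ _ => Commute.zero_right _⟩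
  | add w₁ w₂ _ _ h₁ h₂ =>
    obtain ⟨X₁, h1, h2⟩ := h₁
    obtain ⟨X₂, h3, h4⟩ := h₂
    exact ⟨X₁ + X₂, by simp [h1, h3], fun Z hZ => (h2 Z hZ).add_right (h4 Z hZ)⟩
  | smul c w _ h =>
    obtain ⟨X₁, h1, h2⟩ := h
    exact ⟨c • X₁, by simp [h1], fun Z hZ => (h2 Z hZ).smul_right c⟩

/-- Operators which commute with `U(k, j, 𝕋)` and `U(k, l, 𝕋)`, `j ≠ l`, respectively, commute:
the first one acts on the factor `j`, and the second one on the factor `l`, of the tensor product of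
spaces of homogeneous polynomials in the blocks. -/
theorem commute_of_commute_rot (hk : ∀ j, 0 < k j) {j l : Fin m} (hjl : j ≠ l)
    {T S : BergmanSpace (Coord k) lam →L[ℂ] BergmanSpace (Coord k) lam}
    (hT : ∀ A ∈ blockUnitaryScalar k j, Commute T (rot lam (unitaryIso A)))
    (hS : ∀ A ∈ blockUnitaryScalar k l, Commute S (rot lam (unitaryIso A))) : Commute T S := by
  choose X hXc hX using exists_apply_mono_concentrate hk lam j
  choose Y hYc hY using exists_apply_mono_concentrate hk lam l
  have hXY : ∀ γ δ, Commute (X γ) (Y δ) := fun γ δ => by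
    refine hYc _ _ fun C => (hXc _ _ fun B => ?_).symm
    exact rot_unitaryIso_commute (blockDiag_mulSingle_commute hjl B C).symm
  have hTY : ∀ δ, Commute T (Y δ) := fun δ =>
    hYc _ _ fun C => hT _ (blockDiag_mulSingle_mem hjl.symm C)
  have hSX : ∀ γ, Commute S (X γ) := fun γ =>
    hXc _ _ fun B => hS _ (blockDiag_mulSingle_mem hjl B)
  refine ext_mono fun α => ?_
  set v := mono lam (concentrate hk j (concentrate hk l α)) with hv
  have hv' : v = mono lam (concentrate hk l (concentrate hk j α)) := by
    rw [hv, concentrate_comm hk hjl]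
  set X₁ := X fun p => α ⟨j, p⟩ with hX₁
  set Y₁ := Y fun p => α ⟨l, p⟩ with hY₁
  have hXv : X₁ v = mono lam (concentrate hk l α) :=
    hX _ _ fun p => concentrate_apply_of_ne hk hjl α
  have hYv : Y₁ v = mono lam (concentrate hk j α) := by
    rw [hv']
    exact hY _ _ fun p => concentrate_apply_of_ne hk hjl.symm α
  have hXYv : X₁ (Y₁ v) = mono lam α := by
    rw [hYv]
    exact hX _ _ fun p => rfl
  obtain ⟨X₂, hX₂, hX₂c⟩ := exists_apply_concentrate_eq hk hT hX (concentrate hk l α)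
  obtain ⟨Y₂, hY₂, hY₂c⟩ := exists_apply_concentrate_eq hk hS hY (concentrate hk j α)
  rw [← hv, ← hXv] at hX₂
  rw [← hv', ← hYv] at hY₂
  have hX₂Y : ∀ δ, Commute X₂ (Y δ) := fun δ => (hX₂c _ fun γ => (hXY γ δ).symm).symm
  have swap : ∀ {P Q : BergmanSpace (Coord k) lam →L[ℂ] BergmanSpace (Coord k) lam},
      Commute P Q → ∀ w, P (Q w) = Q (P w) := fun h w => DFunLike.congr_fun h.eq w
  -- both products map `X₁ Y₁ v` to `Y₂ X₂ v`
  have h1 : T (S (mono lam α)) = Y₂ (X₂ v) := by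
    rw [← hXYv, swap (hSX _), ← hY₂, swap (hY₂c _ fun δ => hXY _ δ), swap (hY₂c _ hTY), hX₂]
  have h2 : S (T (mono lam α)) = Y₂ (X₂ v) := by
    rw [← hXYv, swap (hXY _ _), swap (hTY _), ← hX₂, ← swap (hX₂Y _), swap (hX₂c _ hSX), ← hY₂,
      swap (hY₂c _ hX₂Y)]
  exact h1.trans h2.symm

/-- Toeplitz operators with quasi-radial quasi-homogeneous symbols for different blocks commute. -/
theorem toeplitz_commute (hk : ∀ j, 0 < k j) {j l : Fin m} (hjl : j ≠ l)
    {a b : SymbolSpace (Coord k)} (ha : IsQuasiRadialQuasiHomogeneous k j a)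
    (hb : IsQuasiRadialQuasiHomogeneous k l b) : Commute (toeplitz lam a) (toeplitz lam b) :=
  commute_of_commute_rot hk hjl (fun _ hA => ha.commute_rot hA) fun _ hA => hb.commute_rot hA

theorem IsQuasiRadial.isQuasiRadialQuasiHomogeneous {a : SymbolSpace (Coord k)}
    (ha : IsQuasiRadial k a) (j : Fin m) : IsQuasiRadialQuasiHomogeneous k j a := by
  rintro _ ⟨B, -, rfl⟩
  exact ha _ ⟨B, rfl⟩

theorem toeplitz_commute_of_mem_symbolSet (hm : 2 ≤ m) (hk : ∀ j, 0 < k j)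
    {a : Fin m → SymbolSpace (Coord k)} (ha : ∀ j, IsQuasiRadialQuasiHomogeneous k j (a j))
    {b c : SymbolSpace (Coord k)} (hb : b ∈ symbolSet k a) (hc : c ∈ symbolSet k a) :
    Commute (toeplitz lam b) (toeplitz lam c) := by
  have : Nontrivial (Fin m) := Fin.nontrivial_iff_two_le.2 hm
  rcases hb with hb | ⟨j, rfl⟩ <;> rcases hc with hc | ⟨l, rfl⟩
  · obtain ⟨j, l, hjl⟩ := exists_pair_ne (Fin m)
    exact toeplitz_commute hk hjl (IsQuasiRadial.isQuasiRadialQuasiHomogeneous hb j)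
      (IsQuasiRadial.isQuasiRadialQuasiHomogeneous hc l)
  · obtain ⟨j, hj⟩ := exists_ne l
    exact toeplitz_commute hk hj (IsQuasiRadial.isQuasiRadialQuasiHomogeneous hb j) (ha l)
  · obtain ⟨l, hl⟩ := exists_ne j
    exact toeplitz_commute hk hl.symm (ha j) (IsQuasiRadial.isQuasiRadialQuasiHomogeneous hc l)
  · by_cases h : j = l
    · subst h; exact Commute.refl _
    · exact toeplitz_commute hk h (ha j) (ha l)

theorem toeplitzAlgebra_mul_comm (hm : 2 ≤ m) (hk : ∀ j, 0 < k j)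
    {a : Fin m → SymbolSpace (Coord k)} (ha : ∀ j, IsQuasiRadialQuasiHomogeneous k j (a j))
    {X Y : BergmanSpace (Coord k) lam →L[ℂ] BergmanSpace (Coord k) lam}
    (hX : X ∈ toeplitzAlgebra lam (symbolSet k a)) (hY : Y ∈ toeplitzAlgebra lam (symbolSet k a)) :
    X * Y = Y * X := by
  have hcl : ∀ Z : BergmanSpace (Coord k) lam →L[ℂ] BergmanSpace (Coord k) lam,
      (∀ b ∈ toeplitz lam '' symbolSet k a, Commute Z b) →
      ∀ W ∈ toeplitzAlgebra lam (symbolSet k a), Commute Z W := by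
    intro Z hZ W hW
    refine closure_minimal (fun V hV => ?_)
      (isClosed_eq (continuous_const_mul Z) (continuous_mul_const Z)) hW
    exact Algebra.commute_of_mem_adjoin_of_forall_mem_commute hV hZ
  refine hcl X (fun b hb => (hcl b (fun c hc => ?_) X hX).symm) Y hY
  obtain ⟨b, hb, rfl⟩ := hb
  obtain ⟨c, hc, rfl⟩ := hc
  exact toeplitz_commute_of_mem_symbolSet hm hk ha hb hc

end Block

/-! ### Toeplitz operators with continuous symbols -/

section Symbol

theorem continuous_coord_mul_conj {ι : Type*} (p q : ι) :
    Continuous fun z : EuclideanSpace ℂ ι => z p * conj (z q) := by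
  fun_prop

variable {ι : Type*} [Fintype ι]

theorem memLp_top_of_continuous {f : EuclideanSpace ℂ ι → ℂ} (hf : Continuous f) :
    MemLp f ∞ (volume.restrict (ball (0 : EuclideanSpace ℂ ι) 1)) := by
  obtain ⟨M, hM⟩ := (isCompact_closedBall (0 : EuclideanSpace ℂ ι) 1).exists_bound_of_continuousOn
    hf.continuousOn
  refine memLp_top_of_bound hf.aestronglyMeasurable M ?_
  filter_upwards [ae_restrict_mem measurableSet_ball] with z hz
    using hM z (ball_subset_closedBall hz)

/-- The symbol given by a continuous function on `ℂⁿ`. -/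
noncomputable def symbolOf {f : EuclideanSpace ℂ ι → ℂ} (hf : Continuous f) : SymbolSpace ι :=
  (memLp_top_of_continuous hf).toLp f

theorem symbolOf_ae {f : EuclideanSpace ℂ ι → ℂ} (hf : Continuous f) :
    symbolOf hf =ᵐ[volume.restrict (ball (0 : EuclideanSpace ℂ ι) 1)] f :=
  MemLp.coeFn_toLp _

theorem isInvariant_symbolOf [DecidableEq ι] {f : EuclideanSpace ℂ ι → ℂ} (hf : Continuous f)
    {H : Subgroup (Matrix.unitaryGroup ι ℂ)}
    (h : ∀ A ∈ H, ∀ z, f (unitaryIso A z) = f z) : IsInvariant H (symbolOf hf) := by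
  intro A hA
  have h1 := (measurePreserving_ball (unitaryIso A)).quasiMeasurePreserving.ae (symbolOf_ae hf)
  filter_upwards [h1, symbolOf_ae hf] with z h2 h3
  exact (h2.trans (h A hA z)).trans h3.symm

variable {lam : ℝ}

/-- The Toeplitz operator with a real symbol is symmetric. -/
theorem inner_toeplitz_symm {f : EuclideanSpace ℂ ι → ℂ} (hf : Continuous f)
    (hreal : ∀ z, conj (f z) = f z) (u v : BergmanSpace ι lam) :
    inner ℂ (toeplitz lam (symbolOf hf) u) v = inner ℂ u (toeplitz lam (symbolOf hf) v) := by
  rw [← inner_conj_symm, inner_toeplitz, inner_toeplitz, ← integral_conj]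
  refine integral_congr_ae ?_
  filter_upwards [(weightedVolume_ac lam).ae_le (symbolOf_ae hf)] with z h
  simp only [map_mul, Complex.conj_conj, h, hreal]
  ring

variable [IsFiniteMeasure (weightedVolume ι lam)]

theorem toL2_mono (α : ι → ℕ) :
    toL2 lam (mono lam α) =ᵐ[weightedVolume ι lam] fun z => ∏ i, z i ^ α i := by
  refine (toL2_polyVec _).trans (Eventually.of_forall fun z => ?_)
  simp

theorem inner_mono_toeplitz {f : EuclideanSpace ℂ ι → ℂ} (hf : Continuous f) (α β : ι → ℕ) :
    inner ℂ (mono lam β) (toeplitz lam (symbolOf hf) (mono lam α)) =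
      ∫ z, conj (∏ i, z i ^ β i) * (f z * ∏ i, z i ^ α i) ∂weightedVolume ι lam := by
  rw [inner_toeplitz]
  refine integral_congr_ae ?_
  filter_upwards [toL2_mono (lam := lam) α, toL2_mono (lam := lam) β,
    (weightedVolume_ac lam).ae_le (symbolOf_ae hf)] with z h1 h2 h3
  rw [h1, h2, h3]

theorem inner_mono_eq_integral (α β : ι → ℕ) :
    inner ℂ (mono lam β) (mono lam α) =
      ∫ z, conj (∏ i, z i ^ β i) * ∏ i, z i ^ α i ∂weightedVolume ι lam := by
  rw [inner_eq_integral]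
  refine integral_congr_ae ?_
  filter_upwards [toL2_mono (lam := lam) α, toL2_mono (lam := lam) β] with z h1 h2
  rw [h1, h2]

theorem mono_ne_zero (hlam : -1 < lam) (α : ι → ℕ) : mono lam α ≠ 0 := by
  intro h0
  have h1 : (fun z : EuclideanSpace ℂ ι => ∏ i, z i ^ α i) =ᵐ[volume.restrict (ball 0 1)] 0 := by
    refine (ac_weightedVolume hlam).ae_le ?_
    have h2 := (toL2_mono (lam := lam) α).symm
    rw [h0, map_zero] at h2
    exact h2.trans (Lp.coeFn_zero _ _ _)
  have h2 := Measure.eqOn_open_of_ae_eq h1 isOpen_ball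
    (Continuous.continuousOn (by fun_prop)) continuousOn_const
  obtain ⟨r, hr, hrb⟩ : ∃ r : ℝ, 0 < r ∧
      (WithLp.toLp 2 fun _ : ι => (r : ℂ)) ∈ ball (0 : EuclideanSpace ℂ ι) 1 := by
    have hc : ContinuousAt
        (fun r : ℝ => (WithLp.toLp 2 fun _ : ι => (r : ℂ) : EuclideanSpace ℂ ι)) 0 :=
      Continuous.continuousAt (by fun_prop)
    have h0' : (WithLp.toLp 2 fun _ : ι => ((0 : ℝ) : ℂ) : EuclideanSpace ℂ ι) = 0 := by
      ext; simp
    have hmem := hc.eventually_mem (s := ball (0 : EuclideanSpace ℂ ι) 1) (by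
      rw [h0']; exact ball_mem_nhds _ one_pos)
    obtain ⟨r, hr1, hr2⟩ := ((hmem.filter_mono nhdsWithin_le_nhds).and
      (self_mem_nhdsWithin (s := Set.Ioi (0 : ℝ)))).exists
    exact ⟨r, hr2, hr1⟩
  have h3 := h2 hrb
  simp only [Pi.zero_apply] at h3
  rw [Finset.prod_eq_zero_iff] at h3
  obtain ⟨i, -, hi⟩ := h3
  exact hr.ne' (by exact_mod_cast eq_zero_of_pow_eq_zero hi)

variable [DecidableEq ι]

theorem prod_pow_add_single (z : EuclideanSpace ℂ ι) (α : ι → ℕ) (p : ι) :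
    ∏ i, z i ^ (α + Pi.single p 1 : ι → ℕ) i = (∏ i, z i ^ α i) * z p := by
  simp only [Pi.add_apply, pow_add, Finset.prod_mul_distrib]
  congr 1
  rw [Finset.prod_eq_single p] <;> simp +contextual

theorem inner_mono_toeplitz_coord (p q : ι) (α β : ι → ℕ) :
    inner ℂ (mono lam β) (toeplitz lam (symbolOf (continuous_coord_mul_conj p q)) (mono lam α)) =
      inner ℂ (mono lam (β + Pi.single q 1)) (mono lam (α + Pi.single p 1)) := by
  rw [inner_mono_toeplitz, inner_mono_eq_integral]
  refine integral_congr_ae (Eventually.of_forall fun z => ?_)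
  simp only [prod_pow_add_single, map_mul]
  ring

/-- The Toeplitz operator with symbol `z_p conj z_q` lowers the exponent of `z_q`. -/
theorem toeplitz_coord_mono_eq_zero {p q : ι} (hpq : p ≠ q) {α : ι → ℕ} (hα : α q = 0) :
    toeplitz lam (symbolOf (continuous_coord_mul_conj p q)) (mono lam α) = 0 := by
  refine eq_zero_of_inner_mono fun β => ?_
  rw [inner_mono_toeplitz_coord]
  refine inner_mono_mono fun h => ?_
  have := congrFun h q
  simp [hα, hpq.symm] at this

theorem toeplitz_coord_sq_mono_eq_zero {p q : ι} (hpq : p ≠ q) {α : ι → ℕ} (hα : α q ≤ 1) :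
    toeplitz lam (symbolOf (continuous_coord_mul_conj p q))
      (toeplitz lam (symbolOf (continuous_coord_mul_conj p q)) (mono lam α)) = 0 := by
  set x := toeplitz lam (symbolOf (continuous_coord_mul_conj p q)) with hx
  set F : Set (ι → ℕ) := {β | β + Pi.single q 1 = α + Pi.single p 1} with hF
  have hFf : F.Finite :=
    Set.Subsingleton.finite fun β hβ γ hγ => add_right_cancel (hβ.trans hγ.symm)
  have hmem : x (mono lam α) ∈ Submodule.span ℂ (mono lam '' F) :=
    mem_span_mono hFf fun β hβ => by
      rw [hx, inner_mono_toeplitz_coord]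
      exact inner_mono_mono hβ
  have hle : Submodule.span ℂ (mono lam '' F) ≤
      LinearMap.ker (x : _ →ₗ[ℂ] BergmanSpace ι lam) := by
    rw [Submodule.span_le]
    rintro _ ⟨β, hβ, rfl⟩
    refine toeplitz_coord_mono_eq_zero hpq ?_
    have := congrFun hβ q
    simp [hpq.symm] at this
    omega
  exact hle hmem

theorem toeplitz_coord_single_ne_zero (hlam : -1 < lam) (p q : ι) :
    toeplitz lam (symbolOf (continuous_coord_mul_conj p q)) (mono lam (Pi.single q 1)) ≠ 0 := by
  intro h
  have h1 := inner_mono_toeplitz_coord (lam := lam) p q (Pi.single q 1) (Pi.single p 1)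
  rw [h, inner_zero_right, add_comm, inner_self_eq_norm_sq_to_K] at h1
  have h2 := mono_ne_zero hlam (Pi.single q 1 + Pi.single p 1 : ι → ℕ)
  exact h2 (by simpa using h1.symm)

end Symbol

/-! ### Operators diagonal in a Hilbert basis -/

section Diagonal

variable {H ι : Type*} [NormedAddCommGroup H] [InnerProductSpace ℂ H]

/-- If `y` is diagonal in a Hilbert basis, and `z` kills the finitely many basis vectors for which
the eigenvalue of `y` exceeds `C`, then `‖z y ^ N‖ ≤ ‖z‖ C ^ N`. -/
theorem norm_mul_pow_le (b : HilbertBasis ι ℂ H) {y z : H →L[ℂ] H} {g : ι → ℝ}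
    (hy : ∀ i f, inner ℂ (b i) (y f) = g i * inner ℂ (b i) f) {s : Finset ι}
    (hz : ∀ i ∈ s, z (b i) = 0) {C : ℝ} (hC : 0 ≤ C) (hg : ∀ i ∉ s, |g i| ≤ C) (N : ℕ) :
    ‖z * y ^ N‖ ≤ ‖z‖ * C ^ N := by
  classical
  refine ContinuousLinearMap.opNorm_le_bound _ (by positivity) fun f => ?_
  have hyN : ∀ i, inner ℂ (b i) ((y ^ N) f) = g i ^ N * inner ℂ (b i) f := by
    intro i
    induction N with
    | zero => simp
    | succ N ih =>
      rw [pow_succ', mul_apply_eq_comp, hy, ih]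
      ring
  set w := (y ^ N) f with hw
  set w' := w - ∑ i ∈ s, (inner ℂ (b i) w : ℂ) • b i with hw'
  have h1 : z w = z w' := by
    rw [hw', map_sub, map_sum, Finset.sum_eq_zero, sub_zero]
    intro i hi
    rw [map_smul, hz i hi, smul_zero]
  have h2 : ∀ i, ‖(inner ℂ (b i) w' : ℂ)‖ ^ 2 ≤ (C ^ N) ^ 2 * ‖(inner ℂ (b i) f : ℂ)‖ ^ 2 := by
    intro i
    by_cases hi : i ∈ s
    · have : (inner ℂ (b i) w' : ℂ) = 0 := by
        rw [hw', inner_sub_right, b.orthonormal.inner_right_sum _ hi, sub_self]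
      rw [this, norm_zero, zero_pow two_ne_zero]
      positivity
    · have : (inner ℂ (b i) w' : ℂ) = inner ℂ (b i) w := by
        rw [hw', inner_sub_right, inner_sum, Finset.sum_eq_zero, sub_zero]
        intro l hl
        rw [inner_smul_right, b.orthonormal.inner_eq_zero (fun h : i = l => hi (h ▸ hl)), mul_zero]
      rw [this, hyN, norm_mul, mul_pow, norm_pow, Complex.norm_real, Real.norm_eq_abs]
      gcongr
      exact hg i hi
  have hsum : ∀ v : H, HasSum (fun i => ‖(inner ℂ (b i) v : ℂ)‖ ^ 2) (‖v‖ ^ 2) := by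
    intro v
    have h := b.hasSum_inner_mul_inner v v
    rw [inner_self_eq_norm_sq_to_K] at h
    have h' : ∀ i, (inner ℂ v (b i) : ℂ) * inner ℂ (b i) v =
        ((‖(inner ℂ (b i) v : ℂ)‖ ^ 2 : ℝ) : ℂ) := by
      intro i
      rw [← inner_conj_symm v, Complex.conj_mul']
      push_cast; rfl
    simp_rw [h'] at h
    have h2 := Complex.hasSum_ofReal (x := ‖v‖ ^ 2)
      (f := fun i => ‖(inner ℂ (b i) v : ℂ)‖ ^ 2) |>.1 (by simpa using h)
    exact h2
  have h3 : ‖w'‖ ^ 2 ≤ (C ^ N * ‖f‖) ^ 2 := by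
    rw [mul_pow]
    exact hasSum_le h2 (hsum w') ((hsum f).mul_left _)
  have h4 : ‖w'‖ ≤ C ^ N * ‖f‖ := (sq_le_sq₀ (norm_nonneg _) (by positivity)).1 h3
  calc ‖(z * y ^ N) f‖ = ‖z w'‖ := by rw [mul_apply_eq_comp, ← hw, h1]
    _ ≤ ‖z‖ * ‖w'‖ := z.le_opNorm _
    _ ≤ ‖z‖ * (C ^ N * ‖f‖) := by gcongr
    _ = _ := by ring

end Diagonal

/-! ### The norm in a commutative C*-algebra -/

section CStar

/-- In a commutative C*-algebra, `‖x ^ 2‖ = ‖x‖ ^ 2`. -/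
theorem IsCStarAlgebra.norm_mul_self {B : Type*} [NormedRing B] [NormedAlgebra ℂ B]
    {A : Subalgebra ℂ B} (hA : IsCStarAlgebra A) (hcomm : ∀ x ∈ A, ∀ y ∈ A, x * y = y * x)
    {x : B} (hx : x ∈ A) : ‖x * x‖ = ‖x‖ ^ 2 := by
  obtain ⟨-, s, hss, -, -, hmul, hnorm⟩ := hA
  have hc : ∀ x y : A, x * y = y * x := fun x y => Subtype.ext (hcomm x x.2 y y.2)
  lift x to A using hx
  have h1 : s (s x * x) = s x * x := by rw [hmul, hss]
  have h2 : ‖(s x * x) * (s x * x)‖ = (‖x‖ ^ 2) ^ 2 := by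
    have := hnorm (s x * x)
    rwa [h1, hnorm x] at this
  have h3 : s (x * x) * (x * x) = (s x * x) * (s x * x) := by
    rw [hmul, mul_assoc, ← mul_assoc (s x) x x, hc (s x * x) x, ← mul_assoc, ← mul_assoc,
      mul_assoc (s x * x)]
  have h4 := hnorm (x * x)
  rw [h3, h2] at h4
  have h5 : ‖x‖ ^ 2 = ‖x * x‖ := (sq_eq_sq₀ (by positivity) (norm_nonneg _)).1 h4
  exact h5.symm

end CStar

/-! ### Radial moments -/

section Radial

variable {ι : Type*} [Fintype ι]

/-- Integration in polar coordinates of a radial function times the square of a monomial. -/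
theorem lintegral_radial_mul_monomial [Nonempty ι] (α : ι → ℕ) {h : ℝ → ℝ≥0∞} (hh : Measurable h) :
    ∫⁻ z : EuclideanSpace ℂ ι, h ‖z‖ * ‖∏ i, z i ^ α i‖ₑ ^ 2 =
      (∫⁻ θ, ‖∏ i, (θ : EuclideanSpace ℂ ι) i ^ α i‖ₑ ^ 2
        ∂(volume : Measure (EuclideanSpace ℂ ι)).toSphere) *
      ∫⁻ ρ : Set.Ioi (0 : ℝ), h ρ * ENNReal.ofReal ρ ^ (2 * ∑ i, α i)
        ∂Measure.volumeIoiPow (Module.finrank ℝ (EuclideanSpace ℂ ι) - 1) := by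
  have hPm : Measurable fun z : EuclideanSpace ℂ ι => ‖∏ i, z i ^ α i‖ₑ ^ 2 := by
    have : Continuous fun z : EuclideanSpace ℂ ι => ∏ i, z i ^ α i := by fun_prop
    exact (this.measurable.enorm).pow_const 2
  have hmp := (volume : Measure (EuclideanSpace ℂ ι)).measurePreserving_homeomorphUnitSphereProd
  have h1 : ∫⁻ z : EuclideanSpace ℂ ι, h ‖z‖ * ‖∏ i, z i ^ α i‖ₑ ^ 2 =
      ∫⁻ z : ({0}ᶜ : Set (EuclideanSpace ℂ ι)),
        h ‖(z : EuclideanSpace ℂ ι)‖ * ‖∏ i, (z : EuclideanSpace ℂ ι) i ^ α i‖ₑ ^ 2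
        ∂((volume : Measure (EuclideanSpace ℂ ι)).comap Subtype.val) := by
    rw [lintegral_subtype_comap (measurableSet_singleton (0 : EuclideanSpace ℂ ι)).compl
      (fun z : EuclideanSpace ℂ ι => h ‖z‖ * ‖∏ i, z i ^ α i‖ₑ ^ 2), restrict_compl_singleton]
  rw [h1]
  have h2 := hmp.symm (homeomorphUnitSphereProd (EuclideanSpace ℂ ι)).toMeasurableEquiv
  have h3 := h2.lintegral_comp_emb
    (homeomorphUnitSphereProd (EuclideanSpace ℂ ι)).toMeasurableEquiv.symm.measurableEmbedding
    (fun z : ({0}ᶜ : Set (EuclideanSpace ℂ ι)) =>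
      h ‖(z : EuclideanSpace ℂ ι)‖ * ‖∏ i, (z : EuclideanSpace ℂ ι) i ^ α i‖ₑ ^ 2)
  rw [← h3, ← lintegral_prod_mul
    (f := fun θ : sphere (0 : EuclideanSpace ℂ ι) 1 =>
      ‖∏ i, (θ : EuclideanSpace ℂ ι) i ^ α i‖ₑ ^ 2)
    (g := fun ρ : Set.Ioi (0 : ℝ) => h ρ * ENNReal.ofReal ρ ^ (2 * ∑ i, α i))
    (hPm.comp measurable_subtype_coe).aemeasurable (by fun_prop)]
  refine lintegral_congr fun x => ?_
  have h4 : (((homeomorphUnitSphereProd (EuclideanSpace ℂ ι)).toMeasurableEquiv.symm x :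
      ({0}ᶜ : Set (EuclideanSpace ℂ ι))) : EuclideanSpace ℂ ι) =
      (x.2 : ℝ) • (x.1 : EuclideanSpace ℂ ι) := rfl
  have hρ : 0 < (x.2 : ℝ) := x.2.2
  have h5 : ‖(x.1 : EuclideanSpace ℂ ι)‖ = 1 := by simp
  rw [h4, norm_smul, h5, mul_one, Real.norm_of_nonneg hρ.le]
  have h6 : ∏ i, ((x.2 : ℝ) • (x.1 : EuclideanSpace ℂ ι)) i ^ α i =
      ((x.2 : ℝ) : ℂ) ^ (∑ i, α i) * ∏ i, (x.1 : EuclideanSpace ℂ ι) i ^ α i := by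
    rw [← Finset.prod_pow_eq_pow_sum, ← Finset.prod_mul_distrib]
    refine Finset.prod_congr rfl fun i _ => ?_
    rw [PiLp.smul_apply, Complex.real_smul, mul_pow]
  have h7 : ‖((x.2 : ℝ) : ℂ)‖ₑ = ENNReal.ofReal x.2 := by
    rw [← ofReal_norm, Complex.norm_real, Real.norm_of_nonneg hρ.le]
  rw [h6, enorm_mul, enorm_pow, h7, mul_pow, ← pow_mul, mul_comm (∑ i, α i) 2]
  ring

/-- The radial part of `v_λ`, as a measure on `(0, ∞)` which vanishes off `(0, 1)`. -/
noncomputable def radialMeasure (ι : Type*) [Fintype ι] (lam : ℝ) : Measure (Set.Ioi (0 : ℝ)) :=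
  (Measure.volumeIoiPow (Module.finrank ℝ (EuclideanSpace ℂ ι) - 1)).withDensity fun ρ =>
    (Set.Iio (1 : ℝ)).indicator (fun r => ENNReal.ofReal (Real.Gamma (Fintype.card ι + lam + 1) /
      (Real.pi ^ Fintype.card ι * Real.Gamma (lam + 1)) * (1 - r ^ 2) ^ lam)) ρ

theorem lintegral_weightedVolume_monomial [Nonempty ι] (lam : ℝ) (α : ι → ℕ) {h : ℝ → ℝ≥0∞}
    (hh : Measurable h) :
    ∫⁻ z : EuclideanSpace ℂ ι, h ‖z‖ * ‖∏ i, z i ^ α i‖ₑ ^ 2 ∂weightedVolume ι lam =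
      (∫⁻ θ, ‖∏ i, (θ : EuclideanSpace ℂ ι) i ^ α i‖ₑ ^ 2
        ∂(volume : Measure (EuclideanSpace ℂ ι)).toSphere) *
      ∫⁻ ρ : Set.Ioi (0 : ℝ), h ρ * ENNReal.ofReal ρ ^ (2 * ∑ i, α i) ∂radialMeasure ι lam := by
  set w : ℝ → ℝ≥0∞ := fun r => ENNReal.ofReal (Real.Gamma (Fintype.card ι + lam + 1) /
      (Real.pi ^ Fintype.card ι * Real.Gamma (lam + 1)) * (1 - r ^ 2) ^ lam) with hw
  have hwm : Measurable w := by fun_prop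
  have hwi : Measurable ((Set.Iio (1 : ℝ)).indicator w) := hwm.indicator measurableSet_Iio
  have hPm : Measurable fun z : EuclideanSpace ℂ ι => ‖∏ i, z i ^ α i‖ₑ ^ 2 := by
    have : Continuous fun z : EuclideanSpace ℂ ι => ∏ i, z i ^ α i := by fun_prop
    exact (this.measurable.enorm).pow_const 2
  have h1 := lintegral_radial_mul_monomial α (h := fun r => (Set.Iio (1 : ℝ)).indicator w r * h r)
    (hwi.mul hh)
  rw [radialMeasure, lintegral_withDensity_eq_lintegral_mul _
    (by exact hwi.comp measurable_subtype_coe)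
    (by fun_prop)]
  simp only [Pi.mul_apply, ← mul_assoc]
  simp only [← hw]
  rw [← h1, weightedVolume, lintegral_withDensity_eq_lintegral_mul _ (by fun_prop) (by fun_prop),
    ← lintegral_indicator measurableSet_ball]
  refine lintegral_congr fun z => ?_
  by_cases hz : ‖z‖ < 1
  · rw [Set.indicator_of_mem (by simpa using hz), Set.indicator_of_mem (by simpa using hz)]
    simp only [Pi.mul_apply, hw, mul_assoc]
  · rw [Set.indicator_of_notMem (by simpa using hz), Set.indicator_of_notMem (by simpa using hz)]
    simp

variable {lam : ℝ}

theorem radialMeasure_ae_lt_one : ∀ᵐ ρ : Set.Ioi (0 : ℝ) ∂radialMeasure ι lam, (ρ : ℝ) < 1 := by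
  refine (ae_withDensity_iff ?_).2 (Eventually.of_forall fun ρ hρ => ?_)
  · refine Measurable.comp (g := (Set.Iio (1 : ℝ)).indicator _) ?_ measurable_subtype_coe
    exact Measurable.indicator (by fun_prop) measurableSet_Iio
  · by_contra h
    exact hρ (Set.indicator_of_notMem (s := Set.Iio (1 : ℝ)) h _)

theorem radialMeasure_singleton (ρ : Set.Ioi (0 : ℝ)) : radialMeasure ι lam {ρ} = 0 := by
  refine (withDensity_absolutelyContinuous _ _) ((withDensity_absolutelyContinuous _ _) ?_)
  rw [(MeasurableEmbedding.subtype_coe measurableSet_Ioi).comap_apply, Set.image_singleton]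
  simp

theorem isFiniteMeasure_radialMeasure [Nonempty ι] [IsFiniteMeasure (weightedVolume ι lam)] :
    IsFiniteMeasure (radialMeasure ι lam) := by
  refine ⟨lt_top_iff_ne_top.2 fun h => ?_⟩
  have h1 := lintegral_weightedVolume_monomial (ι := ι) lam 0 (h := fun _ => 1) measurable_const
  simp only [Pi.zero_apply, pow_zero, Finset.prod_const_one, enorm_one, one_pow, mul_one,
    lintegral_const, one_mul, Finset.sum_const_zero, mul_zero, h] at h1
  have h2 : (volume : Measure (EuclideanSpace ℂ ι)).toSphere Set.univ ≠ 0 := fun h0 =>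
    (volume : Measure (EuclideanSpace ℂ ι)).toSphere_ne_zero (Measure.measure_univ_eq_zero.1 h0)
  rw [ENNReal.mul_top h2] at h1
  exact measure_ne_top _ _ h1

/-- The moments of the radial part of `v_λ`. -/
noncomputable def radialMoment (ι : Type*) [Fintype ι] (lam : ℝ) (d : ℕ) : ℝ :=
  ∫ ρ, (ρ : ℝ) ^ (2 * d) ∂radialMeasure ι lam

theorem integrable_radial [IsFiniteMeasure (radialMeasure ι lam)] (d : ℕ) :
    Integrable (fun ρ : Set.Ioi (0 : ℝ) => (ρ : ℝ) ^ (2 * d)) (radialMeasure ι lam) := by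
  refine Integrable.of_bound (Continuous.aestronglyMeasurable (by fun_prop)) 1 ?_
  filter_upwards [radialMeasure_ae_lt_one] with ρ hρ
  have := ρ.2
  rw [Set.mem_Ioi] at this
  rw [Real.norm_of_nonneg (by positivity)]
  exact pow_le_one₀ this.le hρ.le

theorem lintegral_radial_eq_ofReal [IsFiniteMeasure (radialMeasure ι lam)] (d : ℕ) :
    ∫⁻ ρ : Set.Ioi (0 : ℝ), ENNReal.ofReal ρ ^ (2 * d) ∂radialMeasure ι lam =
      ENNReal.ofReal (radialMoment ι lam d) := by
  rw [radialMoment, ofReal_integral_eq_lintegral_ofReal (integrable_radial d)]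
  · exact lintegral_congr fun ρ => (ENNReal.ofReal_pow (le_of_lt ρ.2) _).symm
  · refine Eventually.of_forall fun ρ => ?_
    have : (0 : ℝ) < ρ := ρ.2
    simp only [Pi.zero_apply]
    positivity

theorem radialMoment_nonneg (d : ℕ) : 0 ≤ radialMoment ι lam d :=
  integral_nonneg fun ρ => by
    have : (0 : ℝ) < ρ := ρ.2
    simp only [Pi.zero_apply]
    positivity

/-- The moments of the radial measure are strictly logarithmically convex. -/
theorem radialMoment_sq_lt [IsFiniteMeasure (radialMeasure ι lam)] {d : ℕ}
    (hd : 0 < radialMoment ι lam d) :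
    radialMoment ι lam (d + 1) ^ 2 < radialMoment ι lam d * radialMoment ι lam (d + 2) := by
  set D := radialMoment ι lam with hD
  -- the mean value of `ρ ^ 2` with respect to `ρ ^ (2 d)` times the measure
  set c := D (d + 1) / D d with hc
  have hexp : ∫ ρ : Set.Ioi (0 : ℝ), (ρ : ℝ) ^ (2 * d) * ((ρ : ℝ) ^ 2 - c) ^ 2
      ∂radialMeasure ι lam = D (d + 2) - 2 * c * D (d + 1) + c ^ 2 * D d := by
    have h : ∀ ρ : Set.Ioi (0 : ℝ), (ρ : ℝ) ^ (2 * d) * ((ρ : ℝ) ^ 2 - c) ^ 2 =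
        (ρ : ℝ) ^ (2 * (d + 2)) - 2 * c * (ρ : ℝ) ^ (2 * (d + 1)) + c ^ 2 * (ρ : ℝ) ^ (2 * d) := by
      intro ρ; ring
    simp_rw [h]
    rw [integral_add, integral_sub, integral_const_mul, integral_const_mul]
    · rfl
    · exact integrable_radial _
    · exact (integrable_radial _).const_mul _
    · exact (integrable_radial _).sub ((integrable_radial _).const_mul _)
    · exact (integrable_radial _).const_mul _
  have hnn : ∀ ρ : Set.Ioi (0 : ℝ), 0 ≤ (ρ : ℝ) ^ (2 * d) * ((ρ : ℝ) ^ 2 - c) ^ 2 := fun ρ => by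
    have : (0 : ℝ) < ρ := ρ.2
    positivity
  have hint : Integrable (fun ρ : Set.Ioi (0 : ℝ) => (ρ : ℝ) ^ (2 * d) * ((ρ : ℝ) ^ 2 - c) ^ 2)
      (radialMeasure ι lam) := by
    have h : ∀ ρ : Set.Ioi (0 : ℝ), (ρ : ℝ) ^ (2 * d) * ((ρ : ℝ) ^ 2 - c) ^ 2 =
        (ρ : ℝ) ^ (2 * (d + 2)) - 2 * c * (ρ : ℝ) ^ (2 * (d + 1)) + c ^ 2 * (ρ : ℝ) ^ (2 * d) := by
      intro ρ; ring
    simp_rw [h]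
    exact ((integrable_radial _).sub ((integrable_radial _).const_mul _)).add
      ((integrable_radial _).const_mul _)
  have hpos : 0 < ∫ ρ : Set.Ioi (0 : ℝ), (ρ : ℝ) ^ (2 * d) * ((ρ : ℝ) ^ 2 - c) ^ 2
      ∂radialMeasure ι lam := by
    refine lt_of_le_of_ne (integral_nonneg hnn) fun h0 => ?_
    have h1 := (integral_eq_zero_iff_of_nonneg hnn hint).1 h0.symm
    -- the integrand vanishes at one point at most, and points are null sets
    have h2 : {ρ : Set.Ioi (0 : ℝ) | (ρ : ℝ) ^ 2 = c}.Subsingleton := by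
      intro ρ hρ σ hσ
      have h3 : (0 : ℝ) < ρ := ρ.2
      have h4 : (0 : ℝ) < σ := σ.2
      exact Subtype.ext ((sq_eq_sq₀ h3.le h4.le).1 (hρ.trans hσ.symm))
    have h3 : radialMeasure ι lam {ρ : Set.Ioi (0 : ℝ) | (ρ : ℝ) ^ 2 = c} = 0 := by
      rcases h2.eq_empty_or_singleton with h | ⟨ρ, h⟩
      · rw [h, measure_empty]
      · rw [h, radialMeasure_singleton]
    have h4 : ∀ᵐ ρ ∂radialMeasure ι lam, False := by
      filter_upwards [h1, measure_eq_zero_iff_ae_notMem.1 h3] with ρ h5 h6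
      have h7 : (0 : ℝ) < ρ := ρ.2
      rcases mul_eq_zero.1 h5 with h8 | h8
      · exact (pow_pos h7 _).ne' h8
      · exact h6 (sub_eq_zero.1 (pow_eq_zero_iff two_ne_zero |>.1 h8))
    have h5 : radialMeasure ι lam = 0 := by
      rw [← ae_eq_bot]
      simpa using h4
    have h6 : D d = 0 := by simp [hD, radialMoment, h5]
    exact hd.ne' h6
  rw [hexp] at hpos
  have h8 : D (d + 1) = c * D d := by rw [hc, div_mul_cancel₀ _ hd.ne']
  have h9 := mul_pos hd hpos
  rw [h8] at h9 ⊢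
  nlinarith

variable [IsFiniteMeasure (weightedVolume ι lam)]

theorem norm_mono_sq_eq_integral (α : ι → ℕ) :
    ‖mono lam α‖ ^ 2 = ∫ z, ‖∏ i, z i ^ α i‖ ^ 2 ∂weightedVolume ι lam := by
  have h := inner_mono_eq_integral (lam := lam) α α
  rw [inner_self_eq_norm_sq_to_K] at h
  simp_rw [Complex.conj_mul', ← Complex.ofReal_pow] at h
  rw [integral_complex_ofReal] at h
  exact Complex.ofReal_injective (by simpa using h)

/-- The mean value of `|z|²` with respect to `|z ^ α|² dv_λ` is a strictly increasing function of
the degree of `α`. -/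
theorem exists_moment_ratio [Nonempty ι] (hlam : -1 < lam) :
    ∃ M : ℕ → ℝ, StrictMono M ∧ (∀ d, M d ≤ 1) ∧ ∀ α : ι → ℕ,
      ∫ z, ‖z‖ ^ 2 * ‖∏ i, z i ^ α i‖ ^ 2 ∂weightedVolume ι lam =
        M (∑ i, α i) * ‖mono lam α‖ ^ 2 := by
  have := isFiniteMeasure_radialMeasure (ι := ι) (lam := lam)
  set D := radialMoment ι lam with hD
  set Sα : (ι → ℕ) → ℝ≥0∞ := fun α => ∫⁻ θ, ‖∏ i, (θ : EuclideanSpace ℂ ι) i ^ α i‖ₑ ^ 2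
        ∂(volume : Measure (EuclideanSpace ℂ ι)).toSphere with hSα
  have h0 : ∀ α : ι → ℕ, ‖mono lam α‖ ^ 2 = (Sα α).toReal * D (∑ i, α i) := by
    intro α
    have h1 := lintegral_weightedVolume_monomial lam α (h := fun _ => 1) measurable_const
    simp only [one_mul] at h1
    rw [lintegral_radial_eq_ofReal] at h1
    rw [norm_mono_sq_eq_integral, integral_eq_lintegral_of_nonneg_ae
      (Eventually.of_forall fun z => by simp only [Pi.zero_apply]; positivity)
      (Continuous.aestronglyMeasurable (by fun_prop))]
    simp only [ENNReal.ofReal_pow (norm_nonneg _), ofReal_norm]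
    rw [h1, ENNReal.toReal_mul, ENNReal.toReal_ofReal (radialMoment_nonneg _)]
  have h1 : ∀ α : ι → ℕ, ∫ z, ‖z‖ ^ 2 * ‖∏ i, z i ^ α i‖ ^ 2 ∂weightedVolume ι lam =
      (Sα α).toReal * D (∑ i, α i + 1) := by
    intro α
    have h1 := lintegral_weightedVolume_monomial lam α (h := fun r => ENNReal.ofReal r ^ 2)
      (by fun_prop)
    simp only [← pow_add] at h1
    rw [show 2 + 2 * ∑ i, α i = 2 * (∑ i, α i + 1) by ring, lintegral_radial_eq_ofReal] at h1
    rw [integral_eq_lintegral_of_nonneg_ae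
      (Eventually.of_forall fun z => by simp only [Pi.zero_apply]; positivity)
      (Continuous.aestronglyMeasurable (by fun_prop))]
    simp only [ENNReal.ofReal_mul (sq_nonneg _), ENNReal.ofReal_pow (norm_nonneg _)]
    simp only [ofReal_norm] at h1 ⊢
    rw [h1, ENNReal.toReal_mul, ENNReal.toReal_ofReal (radialMoment_nonneg _)]
  have hDpos : ∀ d, 0 < D d := by
    intro d
    classical
    obtain ⟨i₀⟩ := ‹Nonempty ι›
    refine lt_of_le_of_ne (radialMoment_nonneg d) fun h => ?_
    have h2 := h0 (Pi.single i₀ d)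
    have hs : ∑ i, (Pi.single i₀ d : ι → ℕ) i = d := by simp
    rw [hs, ← h, mul_zero] at h2
    exact mono_ne_zero hlam (Pi.single i₀ d : ι → ℕ) (by simpa using h2)
  refine ⟨fun d => D (d + 1) / D d, strictMono_nat_of_lt_succ fun d => ?_, fun d => ?_,
    fun α => ?_⟩
  · rw [div_lt_div_iff₀ (hDpos _) (hDpos _), ← sq, mul_comm (D (d + 1 + 1))]
    exact radialMoment_sq_lt (hDpos d)
  · rw [div_le_one (hDpos d)]
    refine integral_mono_ae (integrable_radial _) (integrable_radial _) ?_
    filter_upwards [radialMeasure_ae_lt_one] with ρ hρ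
    exact pow_le_pow_of_le_one (le_of_lt ρ.2) hρ.le (by omega)
  · rw [h1, h0]
    have := (hDpos (∑ i, α i)).ne'
    field_simp

end Radial

/-! ### The Toeplitz operator with symbol `1 - |z|²` -/

section RadialSymbol

variable {ι : Type*} [Fintype ι]

theorem continuous_one_sub_norm_sq :
    Continuous fun z : EuclideanSpace ℂ ι => (1 : ℂ) - (‖z‖ : ℂ) ^ 2 := by
  fun_prop

theorem isInvariant_one_sub_norm_sq [DecidableEq ι] (H : Subgroup (Matrix.unitaryGroup ι ℂ)) :
    IsInvariant H (symbolOf (continuous_one_sub_norm_sq (ι := ι))) :=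
  isInvariant_symbolOf _ fun A _ z => by rw [LinearIsometryEquiv.norm_map]

variable {lam : ℝ} [IsFiniteMeasure (weightedVolume ι lam)]

/-- The monomials are eigenvectors of the Toeplitz operator with symbol `1 - |z|²`, since this
operator commutes with all diagonal unitary matrices. -/
theorem exists_toeplitz_one_sub_norm_sq_mono [Nonempty ι] [DecidableEq ι] (hlam : -1 < lam) :
    ∃ g : ℕ → ℝ, StrictAnti g ∧ (∀ d, 0 ≤ g d) ∧ ∀ α : ι → ℕ,
      toeplitz lam (symbolOf continuous_one_sub_norm_sq) (mono lam α) =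
        (g (∑ i, α i) : ℂ) • mono lam α := by
  obtain ⟨M, hM, hM1, hMα⟩ := exists_moment_ratio (ι := ι) hlam
  refine ⟨fun d => 1 - M d, fun a b hab => sub_lt_sub_left (hM hab) _,
    fun d => sub_nonneg.2 (hM1 d), fun α => ?_⟩
  set y := toeplitz lam (symbolOf (continuous_one_sub_norm_sq (ι := ι))) with hy
  have hmem : y (mono lam α) ∈ Submodule.span ℂ (mono lam '' {α}) := by
    refine mem_span_mono (Set.finite_singleton α) fun β hβ => ?_
    obtain ⟨q, hq⟩ := Function.ne_iff.1 (Ne.symm hβ)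
    obtain ⟨c, hc⟩ := exists_circle_pow_ne hq
    refine inner_mono_eq_zero (t := Pi.mulSingle q c)
      ((isInvariant_one_sub_norm_sq ⊤).commute_rot (Subgroup.mem_top _)) ?_
    rwa [prod_single_pow, prod_single_pow]
  rw [Set.image_singleton, Submodule.mem_span_singleton] at hmem
  obtain ⟨c, hc⟩ := hmem
  have hpos : (0 : ℝ) < ‖mono lam α‖ := norm_pos_iff.2 (mono_ne_zero hlam α)
  have hint : ∀ n : ℕ, Integrable
      (fun z : EuclideanSpace ℂ ι => (‖z‖ ^ 2) ^ n * ‖∏ i, z i ^ α i‖ ^ 2)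
      (weightedVolume ι lam) := by
    intro n
    obtain ⟨C, hC⟩ := (isCompact_closedBall (0 : EuclideanSpace ℂ ι) 1).exists_bound_of_continuousOn
      (f := fun z : EuclideanSpace ℂ ι => (‖z‖ ^ 2) ^ n * ‖∏ i, z i ^ α i‖ ^ 2)
      (Continuous.continuousOn (by fun_prop))
    refine Integrable.of_bound (Continuous.aestronglyMeasurable (by fun_prop)) C ?_
    filter_upwards [ae_mem_ball lam] with z hz using hC z (ball_subset_closedBall hz)
  have h1 : inner ℂ (mono lam α) (y (mono lam α)) =
      (((1 - M (∑ i, α i)) * ‖mono lam α‖ ^ 2 : ℝ) : ℂ) := by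
    rw [hy, inner_mono_toeplitz]
    have h2 : ∀ z : EuclideanSpace ℂ ι,
        conj (∏ i, z i ^ α i) * (((1 : ℂ) - (‖z‖ : ℂ) ^ 2) * ∏ i, z i ^ α i) =
          ((‖∏ i, z i ^ α i‖ ^ 2 - ‖z‖ ^ 2 * ‖∏ i, z i ^ α i‖ ^ 2 : ℝ) : ℂ) := by
      intro z
      rw [mul_left_comm, Complex.conj_mul']
      push_cast
      ring
    simp_rw [h2]
    rw [integral_complex_ofReal, integral_sub (by simpa using hint 0) (by simpa using hint 1), hMα,
      ← norm_mono_sq_eq_integral]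
    push_cast
    ring
  rw [← hc, inner_smul_right, inner_self_eq_norm_sq_to_K] at h1
  have h3 : ((‖mono lam α‖ ^ 2 : ℝ) : ℂ) ≠ 0 := by exact_mod_cast (pow_pos hpos 2).ne'
  have h4 : c = ((1 - M (∑ i, α i) : ℝ) : ℂ) := by
    refine mul_right_cancel₀ h3 ?_
    rw [← Complex.ofReal_mul, ← h1]
    push_cast
    rfl
  rw [← hc, h4]

/-- The normalized monomials form a Hilbert basis of the Bergman space. -/
theorem exists_hilbertBasis_mono (hlam : -1 < lam) :
    ∃ b : HilbertBasis (ι → ℕ) ℂ (BergmanSpace ι lam),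
      ∀ α, b α = ((‖mono lam α‖ : ℂ)⁻¹) • mono lam α := by
  classical
  have hne : ∀ α : ι → ℕ, (‖mono lam α‖ : ℂ) ≠ 0 := fun α => by
    simpa using mono_ne_zero hlam α
  have ho : Orthonormal ℂ fun α : ι → ℕ => ((‖mono lam α‖ : ℂ)⁻¹) • mono lam α := by
    refine ⟨fun α => norm_smul_inv_norm (𝕜 := ℂ) (mono_ne_zero hlam α), fun α β hαβ => ?_⟩
    simp only
    rw [inner_smul_left, inner_smul_right, inner_mono_mono hαβ, mul_zero, mul_zero]
  refine ⟨HilbertBasis.mkOfOrthogonalEqBot ho ?_,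
    fun α => congrFun (HilbertBasis.coe_mkOfOrthogonalEqBot ho _) α⟩
  rw [Submodule.eq_bot_iff]
  intro f hf
  refine eq_zero_of_inner_mono fun α => ?_
  have h := (Submodule.mem_orthogonal _ _).1 hf _ (Submodule.subset_span ⟨α, rfl⟩)
  rw [inner_smul_left] at h
  exact (mul_eq_zero.1 h).resolve_left (by simpa using hne α)

/-- If the Toeplitz operators `x` and `y` with symbols `z_p conj z_q` and `1 - |z|²` commute, then
some operator `w = x y ^ N` fails to satisfy `‖w²‖ = ‖w‖²`: the operator `x²` kills the monomials of
degree `0` and `1`, on which `y` is largest, while `x` does not kill `z_q`. -/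
theorem exists_norm_mul_self_ne [Nonempty ι] [DecidableEq ι] (hlam : -1 < lam) {p q : ι}
    (hpq : p ≠ q)
    (hcomm : Commute (toeplitz lam (symbolOf (continuous_coord_mul_conj p q)))
      (toeplitz lam (symbolOf continuous_one_sub_norm_sq))) :
    ∃ N : ℕ, ∃ w, w = toeplitz lam (symbolOf (continuous_coord_mul_conj p q)) *
      toeplitz lam (symbolOf continuous_one_sub_norm_sq) ^ N ∧ ‖w * w‖ ≠ ‖w‖ ^ 2 := by
  obtain ⟨g, hg, hg0, hyg⟩ := exists_toeplitz_one_sub_norm_sq_mono (ι := ι) hlam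
  obtain ⟨b, hb⟩ := exists_hilbertBasis_mono (ι := ι) hlam
  have hsymm := inner_toeplitz_symm (lam := lam) (continuous_one_sub_norm_sq (ι := ι))
    fun z => by simp
  have hx1 := toeplitz_coord_single_ne_zero hlam p q
  have hx2 := fun α => toeplitz_coord_sq_mono_eq_zero (lam := lam) hpq (α := α)
  set x := toeplitz lam (symbolOf (continuous_coord_mul_conj p q)) with hx
  set y := toeplitz lam (symbolOf (continuous_one_sub_norm_sq (ι := ι))) with hy
  set e := mono lam (Pi.single q 1 : ι → ℕ) with he
  by_contra! hcon
  have hfin : {α : ι → ℕ | ∑ i, α i ≤ 1}.Finite :=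
    (Set.finite_Iic (fun _ => 1 : ι → ℕ)).subset fun α hα i =>
      (Finset.single_le_sum (fun _ _ => Nat.zero_le _) (Finset.mem_univ i)).trans hα
  have hup : ∀ N : ℕ, ‖x * x * y ^ N‖ ≤ ‖x * x‖ * g 2 ^ N := by
    refine norm_mul_pow_le b (g := fun α => g (∑ i, α i)) (fun α f => ?_) (s := hfin.toFinset)
      (fun α hα => ?_) (hg0 2) (fun α hα => ?_)
    · rw [← hsymm, hb, map_smul, hyg, smul_comm, inner_smul_left, Complex.conj_ofReal]
    · have h1 : ∑ i, α i ≤ 1 := by simpa using hα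
      have h2 : α q ≤ 1 :=
        (Finset.single_le_sum (fun _ _ => Nat.zero_le _) (Finset.mem_univ q)).trans h1
      rw [hb, map_smul, mul_apply_eq_comp, hx2 α h2, smul_zero]
    · have h1 : ¬ ∑ i, α i ≤ 1 := by simpa using hα
      rw [abs_of_nonneg (hg0 _)]
      exact hg.antitone (by omega)
  -- evaluation at `z_q`
  have hlow : ∀ N : ℕ, g 1 ^ N * ‖x e‖ ≤ ‖x * y ^ N‖ * ‖e‖ := by
    intro N
    have h1 : (y ^ N) e = ((g 1 ^ N : ℝ) : ℂ) • e := by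
      induction N with
      | zero => simp
      | succ N ih =>
        rw [pow_succ', mul_apply_eq_comp, ih, map_smul, he, hyg, smul_smul]
        congr 1
        simp [pow_succ]
    have h2 := (x * y ^ N).le_opNorm e
    rwa [mul_apply_eq_comp, h1, map_smul, norm_smul, Complex.norm_real, Real.norm_of_nonneg
      (pow_nonneg (hg0 1) N)] at h2
  have hg12 : g 2 < g 1 := hg (by norm_num)
  have hg1 : 0 < g 1 := (hg0 2).trans_lt hg12
  have hkey : ∀ N : ℕ, ‖x e‖ ^ 2 ≤ ‖x * x‖ * ‖e‖ ^ 2 * ((g 2 / g 1) ^ 2) ^ N := by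
    intro N
    have hw := hcon N _ rfl
    have h1 : x * y ^ N * (x * y ^ N) = x * x * y ^ (2 * N) := by
      have h2 : y ^ N * x = x * y ^ N := (hcomm.pow_right N).eq.symm
      rw [mul_assoc, ← mul_assoc (y ^ N), h2, mul_assoc x (y ^ N), ← pow_add, ← two_mul,
        ← mul_assoc]
    have h3 : (g 1 ^ N * ‖x e‖) ^ 2 ≤ (‖x * y ^ N‖ * ‖e‖) ^ 2 := by
      have := hlow N
      gcongr
    rw [mul_pow (‖x * y ^ N‖), ← hw, h1] at h3
    have h4 := h3.trans (mul_le_mul_of_nonneg_right (hup (2 * N)) (sq_nonneg ‖e‖))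
    have h5 : 0 < (g 1 ^ N) ^ 2 := by positivity
    have h6 : ((g 2 / g 1) ^ 2) ^ N = g 2 ^ (2 * N) / (g 1 ^ N) ^ 2 := by
      rw [← pow_mul, div_pow, ← pow_mul, mul_comm N 2]
    rw [h6, ← mul_div_assoc, le_div_iff₀ h5]
    linarith [mul_pow (g 1 ^ N) ‖x e‖ 2]
  have hr : (g 2 / g 1) ^ 2 < 1 :=
    pow_lt_one₀ (div_nonneg (hg0 2) hg1.le) ((div_lt_one hg1).2 hg12) two_ne_zero
  have hlim : Tendsto (fun N : ℕ => ‖x * x‖ * ‖e‖ ^ 2 * ((g 2 / g 1) ^ 2) ^ N) atTop (𝓝 0) := by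
    simpa using (tendsto_pow_atTop_nhds_zero_of_lt_one (sq_nonneg _) hr).const_mul
      (‖x * x‖ * ‖e‖ ^ 2)
  have h0 := ge_of_tendsto' hlim hkey
  have : 0 < ‖x e‖ := norm_pos_iff.2 hx1
  nlinarith

end RadialSymbol

/-! ### Failure of the C*-identity -/

section NotCStar

variable {m : ℕ} {k : Fin m → ℕ}

theorem isQuasiRadialQuasiHomogeneous_coord_mul_conj (j : Fin m) (p q : Fin (k j)) :
    IsQuasiRadialQuasiHomogeneous k j
      (symbolOf (continuous_coord_mul_conj (⟨j, p⟩ : Coord k) ⟨j, q⟩)) := by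
  refine isInvariant_symbolOf _ ?_
  rintro _ ⟨B, ⟨t, ht⟩, rfl⟩ z
  have ht' : (B j : Matrix (Fin (k j)) (Fin (k j)) ℂ) = (t : ℂ) • 1 := ht
  have h : ∀ r : Fin (k j), unitaryIso (blockDiag k B) z ⟨j, r⟩ = t * z ⟨j, r⟩ := by
    intro r
    rw [unitaryIso_blockDiag, ht']
    simp [Matrix.one_apply]
  have h1 : (t : ℂ) * conj (t : ℂ) = 1 := by
    rw [Complex.mul_conj', Circle.norm_coe, Complex.ofReal_one, one_pow]
  rw [h, h, map_mul]
  linear_combination (z ⟨j, p⟩ * conj (z ⟨j, q⟩)) * h1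

/-- If one of the symbols `a_j` is `z_p conj z_q`, `p ≠ q`, then the algebra is not a C*-algebra. -/
theorem not_isCStarAlgebra_toeplitzAlgebra (hm : 2 ≤ m) (hk : ∀ j, 0 < k j)
    {a : Fin m → SymbolSpace (Coord k)} (ha : ∀ j, IsQuasiRadialQuasiHomogeneous k j (a j))
    {j : Fin m} {p q : Coord k} (hpq : p ≠ q)
    (haj : a j = symbolOf (continuous_coord_mul_conj p q)) {lam : ℝ} (hlam : -1 < lam) :
    ¬ IsCStarAlgebra (toeplitzAlgebra lam (symbolSet k a)) := by
  intro hA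
  have : Nonempty (Coord k) := ⟨p⟩
  have := isFiniteMeasure_weightedVolume (ι := Coord k) hlam
  have hmem : ∀ b ∈ symbolSet k a, toeplitz lam b ∈ toeplitzAlgebra lam (symbolSet k a) :=
    fun b hb => Subalgebra.le_topologicalClosure _ (Algebra.subset_adjoin ⟨b, hb, rfl⟩)
  have hx := hmem _ (Or.inr ⟨j, haj⟩)
  have hy := hmem (symbolOf continuous_one_sub_norm_sq)
    (Or.inl (isInvariant_one_sub_norm_sq (blockUnitary k)))
  have hcomm := fun X hX Y hY =>
    toeplitzAlgebra_mul_comm (lam := lam) hm hk ha (X := X) (Y := Y) hX hY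
  obtain ⟨N, _, rfl, hN⟩ := exists_norm_mul_self_ne hlam hpq (hcomm _ hx _ hy)
  exact hN (hA.norm_mul_self hcomm (mul_mem hx (pow_mem hy N)))

end NotCStar

end BallToeplitz

/-- Let `k = (k_1, …, k_m)`, `m ≥ 2`, be a partition of `n`. The Banach algebra generated by the
Toeplitz operators with symbols in `S = L^∞(𝔹ⁿ)^{U(k)} ∪ {a_1, …, a_m}`, with `a_j` a
`(k, j)`-quasi-radial quasi-homogeneous symbol, is commutative on every `A²_λ(𝔹ⁿ)`. If `k` is not
`(1, …, 1)`, it is for suitable `a_1, …, a_m` and every `λ > -1` not a C*-algebra. -/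
theorem mainTheorem2 {m : ℕ} (hm : 2 ≤ m) (k : Fin m → ℕ) (hk : ∀ j, 0 < k j) :
    (∀ a : Fin m → BallToeplitz.SymbolSpace (BallToeplitz.Coord k),
      (∀ j, BallToeplitz.IsQuasiRadialQuasiHomogeneous k j (a j)) →
      ∀ lam : ℝ, -1 < lam →
        ∀ X ∈ BallToeplitz.toeplitzAlgebra lam (BallToeplitz.symbolSet k a),
        ∀ Y ∈ BallToeplitz.toeplitzAlgebra lam (BallToeplitz.symbolSet k a),
          X * Y = Y * X) ∧
    ((∃ j, 2 ≤ k j) →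
      ∃ a : Fin m → BallToeplitz.SymbolSpace (BallToeplitz.Coord k),
        (∀ j, BallToeplitz.IsQuasiRadialQuasiHomogeneous k j (a j)) ∧
        ∀ lam : ℝ, -1 < lam →
          ¬ BallToeplitz.IsCStarAlgebra
            (BallToeplitz.toeplitzAlgebra lam (BallToeplitz.symbolSet k a))) := by
  refine ⟨fun a ha lam hlam X hX Y hY => ?_, ?_⟩
  · have : Nonempty (BallToeplitz.Coord k) := ⟨⟨⟨0, by omega⟩, ⟨0, hk _⟩⟩⟩
    have := BallToeplitz.isFiniteMeasure_weightedVolume (ι := BallToeplitz.Coord k) hlam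
    exact BallToeplitz.toeplitzAlgebra_mul_comm hm hk ha hX hY
  · rintro ⟨j, hj⟩
    -- in every block, the symbol is `z_p conj z_q` with `p` the first coordinate of the block and
    -- `q` the last one; these are distinct in the block `j`
    set P : ∀ i, Fin (k i) := fun i => ⟨0, hk i⟩ with hP
    set Q : ∀ i, Fin (k i) := fun i => ⟨k i - 1, Nat.sub_lt (hk i) one_pos⟩ with hQ
    have ha := fun i => BallToeplitz.isQuasiRadialQuasiHomogeneous_coord_mul_conj i (P i) (Q i)
    refine ⟨_, ha, fun lam hlam =>
      BallToeplitz.not_isCStarAlgebra_toeplitzAlgebra hm hk ha (j := j) ?_ rfl hlam⟩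
    intro h
    have h1 : P j = Q j := by simpa using h
    have h2 := congrArg Fin.val h1
    simp only [hP, hQ] at h2
    omega
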